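/- Let $\gamma \ge 6$, $\mu > 0$, $\eta \ge 0$, and $\frac{6\gamma}{5\gamma-6} \le q \le \frac32$. For $1 \le r < 3$ let $D_0^{1,r}(\mathbb{R}^3)$ denote the completion of $C_c^\infty(\mathbb{R}^3)$ with respect to $\|\nabla \varphi\|_{L^r(\mathbb{R}^3)}$, regarded (by Sobolev's inequality) as a space of locally integrable functions, and for vector fields componentwise. Let $G \in D_0^{1,q}(\mathbb{R}^3)$ and set $$\mathbb{S}(\nabla \mathbf{u}) = \mu\left(\nabla \mathbf{u} + \nabla^t \mathbf{u} - \tfrac23 \operatorname{div} \mathbf{u}\, \mathbb{I}\right) + \eta \operatorname{div} \mathbf{u}\, \mathbb{I}.$$ Let $(\rho, \mathbf{u})$ be a weak solution on $\mathbb{R}^3$ of the stationary compressible Navier--Stokes system $$\operatorname{div}(\rho \mathbf{u}) = 0, \qquad \operatorname{div}(\rho \mathbf{u} \otimes \mathbf{u}) + \nabla \rho^\gamma - \operatorname{div} \mathbb{S}(\nabla \mathbf{u}) = \rho \nabla G,$$ that is: $\rho : \mathbb{R}^3 \to \mathbb{R}$ and $\mathbf{u} : \mathbb{R}^3 \to \mathbb{R}^3$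 are measurable; $\rho \ge 0$ a.e.; $\rho$, $\rho \mathbf{u}$, $\rho |\mathbf{u}|^2$, $\rho^\gamma$ and $\rho \nabla G$ are locally integrable; $\mathbf{u} \in D_0^{1,2}(\mathbb{R}^3; \mathbb{R}^3)$; $$\int_{\mathbb{R}^3} \rho \mathbf{u} \cdot \nabla \phi \, dx = 0 \quad \text{for all } \phi \in C_c^\infty(\mathbb{R}^3);$$ and $$\int_{\mathbb{R}^3} \left[\rho \mathbf{u} \otimes \mathbf{u} : \nabla \boldsymbol{\varphi} + \rho^\gamma \operatorname{div} \boldsymbol{\varphi}\right] dx = \int_{\mathbb{R}^3} \mathbb{S}(\nabla \mathbf{u}) : \nabla \boldsymbol{\varphi} \, dx - \int_{\mathbb{R}^3} \rho \nabla G \cdot \boldsymbol{\varphi} \, dx \quad \text{for all } \boldsymbol{\varphi} \in C_c^1(\mathbb{R}^3; \mathbb{R}^3).$$ If $\rho \in L^6(\mathbb{R}^3) \cap L^\gamma(\mathbb{R}^3)$, then $\mathbf{u} = 0$ a.e. in $\mathbb{R}^3$. -/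

import Mathlib

open MeasureTheory Filter Topology
open scoped ENNReal ContDiff

noncomputable section

/-- Three-dimensional Euclidean space. -/
abbrev E3 : Type := EuclideanSpace ℝ (Fin 3)

/-- `φ ∈ C_c^∞(ℝ³)`. -/
def IsTestFunction (φ : E3 → ℝ) : Prop :=
  ContDiff ℝ ∞ φ ∧ HasCompactSupport φ

/-- `g` is the weak (distributional) gradient of `f`, both being locally integrable:
`∫ f ∇φ = - ∫ φ g` for all `φ ∈ C_c^∞(ℝ³)`. -/
structure HasWeakGradient (f : E3 → ℝ) (g : E3 → E3) : Prop where
  locallyIntegrable : LocallyIntegrable f volume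
  locallyIntegrable_grad : LocallyIntegrable g volume
  integral_eq : ∀ φ : E3 → ℝ, IsTestFunction φ →
    ∫ x, f x • gradient φ x = - ∫ x, φ x • g x

open scoped Classical in
/-- The weak gradient `∇f` (unique up to a null set); the value is `0` if `f` has none. -/
def weakGradient (f : E3 → ℝ) : E3 → E3 :=
  if h : ∃ g, HasWeakGradient f g then h.choose else 0

theorem HasWeakGradient.weakGradient {f : E3 → ℝ} {g : E3 → E3} (h : HasWeakGradient f g) :
    HasWeakGradient f (weakGradient f) := by
  have h' : ∃ g, HasWeakGradient f g := ⟨g, h⟩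
  rw [_root_.weakGradient, dif_pos h']
  exact h'.choose_spec

/-- The homogeneous Sobolev space `D_0^{1,q}(ℝ³)`, the completion of `C_c^∞(ℝ³)` with respect to
`φ ↦ ‖∇φ‖_{L^q}`, realised as a space of functions: `f` has a weak gradient in `L^q`, and there are
`φ_n ∈ C_c^∞(ℝ³)` with `∇φ_n → ∇f` in `L^q` and `φ_n → f` in `L¹_loc`. For `1 ≤ q < 3` the
local convergence singles out exactly one function (up to null sets) in each class of the
completion; in particular nonzero constants are not in the space. -/
def MemD10 (q : ℝ≥0∞) (f : E3 → ℝ) : Prop :=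
  HasWeakGradient f (weakGradient f) ∧ MemLp (weakGradient f) q volume ∧
    ∃ φ : ℕ → E3 → ℝ, (∀ n, IsTestFunction (φ n)) ∧
      Tendsto (fun n => eLpNorm (fun x => gradient (φ n) x - weakGradient f x) q volume)
        atTop (𝓝 0) ∧
      ∀ K : Set E3, IsCompact K →
        Tendsto (fun n => eLpNorm (fun x => φ n x - f x) 1 (volume.restrict K)) atTop (𝓝 0)

/-- The space `D_0^{1,q}(ℝ³; ℝ³)` of vector fields. -/
def MemD10Vec (q : ℝ≥0∞) (u : E3 → E3) : Prop :=
  ∀ i, MemD10 q (fun x => u x i)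

/-- The weak Jacobian matrix `(∇u)_{ij} = ∂_j u_i`. -/
def weakJacobian (u : E3 → E3) (x : E3) : Matrix (Fin 3) (Fin 3) ℝ :=
  Matrix.of fun i j => weakGradient (fun y => u y i) x j

/-- The classical Jacobian matrix `(∇φ)_{ij} = ∂_j φ_i`. -/
def jacobian (φ : E3 → E3) (x : E3) : Matrix (Fin 3) (Fin 3) ℝ :=
  Matrix.of fun i j => gradient (fun y => φ y i) x j

/-- The Frobenius product `A : B = ∑ A_{ij} B_{ij}`. -/
def frob (A B : Matrix (Fin 3) (Fin 3) ℝ) : ℝ :=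
  ∑ i, ∑ j, A i j * B i j

/-- The tensor product `v ⊗ v`. -/
def tensorSq (v : E3) : Matrix (Fin 3) (Fin 3) ℝ :=
  Matrix.of fun i j => v i * v j

/-- Newton's viscous stress `S(A) = μ (A + Aᵗ - (2/3) tr(A) I) + η tr(A) I`; for `A = ∇u` the trace
is `div u`. -/
def viscousStress (μ η : ℝ) (A : Matrix (Fin 3) (Fin 3) ℝ) : Matrix (Fin 3) (Fin 3) ℝ :=
  μ • (A + A.transpose - (2 / 3 * A.trace) • (1 : Matrix (Fin 3) (Fin 3) ℝ)) +
    (η * A.trace) • (1 : Matrix (Fin 3) (Fin 3) ℝ)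

/-- Weak solutions `(ρ, u)` on `ℝ³` of the stationary compressible Navier-Stokes system
`div(ρu) = 0`, `div(ρ u ⊗ u) + ∇p(ρ) - div S(∇u) = ρ∇G`. -/
structure IsWeakSolution (μ η : ℝ) (p : ℝ → ℝ) (G : E3 → ℝ) (ρ : E3 → ℝ) (u : E3 → E3) :
    Prop where
  /-- The potential `G` has a weak gradient. -/
  hasWeakGradient_potential : HasWeakGradient G (weakGradient G)
  aemeasurable_density : AEMeasurable ρ volume
  aemeasurable_velocity : AEMeasurable u volume
  density_nonneg : ∀ᵐ x, 0 ≤ ρ x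
  locallyIntegrable_momentum : LocallyIntegrable (fun x => ρ x • u x) volume
  /-- The weak form of the mass balance. -/
  mass_balance : ∀ φ : E3 → ℝ, IsTestFunction φ →
    ∫ x, inner ℝ (ρ x • u x) (gradient φ x) = 0
  locallyIntegrable_density : LocallyIntegrable ρ volume
  locallyIntegrable_kinetic : LocallyIntegrable (fun x => ρ x * ‖u x‖ ^ 2) volume
  locallyIntegrable_pressure : LocallyIntegrable (fun x => p (ρ x)) volume
  locallyIntegrable_force : LocallyIntegrable (fun x => ρ x • weakGradient G x) volume
  memD10_velocity : MemD10Vec 2 u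
  /-- The weak form of the momentum balance, for test fields in `C_c^1(ℝ³; ℝ³)`. -/
  momentum_balance : ∀ φ : E3 → E3, ContDiff ℝ 1 φ → HasCompactSupport φ →
    ∫ x, (ρ x * frob (tensorSq (u x)) (jacobian φ x) + p (ρ x) * (jacobian φ x).trace) =
      (∫ x, frob (viscousStress μ η (weakJacobian u x)) (jacobian φ x)) -
        ∫ x, inner ℝ (ρ x • weakGradient G x) (φ x)

end

/-!
The energy identity, obtained by testing the momentum balance with `u` itself, reads
`∫ S(∇u) : ∇u = ∫ ρ u ⊗ u : ∇u + ∫ ρ^γ div u + ∫ ρ ∇G · u`,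
and each term on the right vanishes. The dissipation on the left equals
`μ ∫ |∇u|² + (μ / 3 + η) ∫ |div u|²`, so `∇u = 0`, and then `u = 0` by Sobolev's inequality.

*Admissibility of `u`.* By Sobolev's inequality `u ∈ L⁶`, and `u` is a limit of test fields, in `L⁶`
and with gradients converging in `L²`. With `ρ ∈ L⁶` this gives `ρ u ⊗ u ∈ L²`, and the range of `q`
is exactly such that the exponent `r` with `1/r + 1/q = 5/6` lies between `6` and `γ`, whence
`ρ ∈ L^r` and `ρ ∇G ∈ L^{6/5}`. The remaining point is `ρ^γ ∈ L²` (`memLp_two_of_weak_gradient`).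
Testing with gradients `∇w` yields `|∫ ρ^γ Δw| ≤ C ‖Δw‖₂`, so by Riesz' theorem there is `f ∈ L²` such that `ρ^γ - f` is harmonic. Its
mollifications are harmonic and in `L²`, because `ρ^γ ∈ L¹`; they vanish by a Liouville theorem
(`eq_zero_of_lap_eq_zero`), and `ρ^γ = f`.

*The convective term and the force.* Both vanish by the mass balance, which extends to the
potentials `|u|² / 2`, with gradient in `L^{3/2}`, and `G`, with gradient in `L^q`.

*The pressure.* `∫ ρ^γ div u = 0` is the integrated renormalised continuity equation
(`integral_rpow_mul_div_eq_zero`). For the mollified density `ρ_ε` the chain rule gives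
`∫ ρ_ε^{γ-1} u · ∇ρ_ε = -(1/γ) ∫ ρ_ε^γ div u`. On the other hand the mass balance turns
`u · ∇ρ_ε` into a Friedrichs commutator, which only involves difference quotients of `u`; since now
`ρ ∈ L^{2γ}` and `∇u ∈ L²`, the left-hand side converges to `-∫ ρ^γ div u` (`tendsto_integral_commutator`). As
`γ ≠ 1`, the common limit is zero.
-/

/-! ### Convergence in `L^p` and products -/

/-- `F i → f` in `L^p(ℝ³)` along `l`, all the functions involved belonging to `L^p`. -/
structure LpLim {ι : Type*} (p : ℝ≥0∞) (l : Filter ι) (F : ι → E3 → ℝ) (f : E3 → ℝ) : Prop where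
  memLp : ∀ i, MemLp (F i) p volume
  memLp_lim : MemLp f p volume
  tendsto : Tendsto (fun i => eLpNorm (fun x => F i x - f x) p volume) l (𝓝 0)

theorem holderTriple_of_toReal {p q r : ℝ≥0∞} (hp : p ≠ 0) (hq : q ≠ 0) (hr : r ≠ 0)
    (h : p.toReal⁻¹ + q.toReal⁻¹ = r.toReal⁻¹) : ENNReal.HolderTriple p q r := by
  refine ⟨(ENNReal.toReal_eq_toReal_iff' ?_ ?_).1 ?_⟩
  · simp [hp, hq]
  · simp [hr]
  · rw [ENNReal.toReal_add (by simp [hp]) (by simp [hq])]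
    simpa [ENNReal.toReal_inv] using h

theorem holderTriple_ofReal {a b c : ℝ} (ha : 0 < a) (hb : 0 < b) (hc : 0 < c)
    (h : a⁻¹ + b⁻¹ = c⁻¹) :
    ENNReal.HolderTriple (ENNReal.ofReal a) (ENNReal.ofReal b) (ENNReal.ofReal c) :=
  holderTriple_of_toReal (by simpa) (by simpa) (by simpa)
    (by simpa [ENNReal.toReal_ofReal, ha.le, hb.le, hc.le] using h)

theorem eLpNorm_mul_le {p q r : ℝ≥0∞} [ENNReal.HolderTriple p q r] {f g : E3 → ℝ}
    (hf : AEStronglyMeasurable f volume) (hg : AEStronglyMeasurable g volume) :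
    eLpNorm (fun x => f x * g x) r volume ≤ eLpNorm f p volume * eLpNorm g q volume := by
  simpa using eLpNorm_le_eLpNorm_mul_eLpNorm_of_nnnorm (p := p) (q := q) (r := r) hf hg
    (fun a b => a * b) 1 (Eventually.of_forall fun x => by simp)

theorem enorm_integral_mul_le {p q : ℝ≥0∞} [ENNReal.HolderTriple p q 1] {f g : E3 → ℝ}
    (hf : AEStronglyMeasurable f volume) (hg : AEStronglyMeasurable g volume) :
    ‖∫ x, f x * g x‖ₑ ≤ eLpNorm f p volume * eLpNorm g q volume :=
  ((enorm_integral_le_lintegral_enorm _).trans_eq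
    eLpNorm_one_eq_lintegral_enorm.symm).trans (eLpNorm_mul_le hf hg)

namespace LpLim

variable {ι : Type*} {p q r : ℝ≥0∞} {l : Filter ι} {F G : ι → E3 → ℝ} {f g : E3 → ℝ}

theorem const (hf : MemLp f p volume) : LpLim p l (fun _ => f) f :=
  ⟨fun _ => hf, hf, by simpa using tendsto_const_nhds⟩

theorem comp {κ : Type*} {l' : Filter κ} (h : LpLim p l F f) {s : κ → ι} (hs : Tendsto s l' l) :
    LpLim p l' (fun k => F (s k)) f :=
  ⟨fun k => h.memLp (s k), h.memLp_lim, h.tendsto.comp hs⟩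

theorem congr_lim (h : LpLim p l F f) (hfg : f =ᵐ[volume] g) : LpLim p l F g := by
  refine ⟨h.memLp, h.memLp_lim.ae_eq hfg, h.tendsto.congr fun i => eLpNorm_congr_ae ?_⟩
  filter_upwards [hfg] with x hx using by rw [hx]

theorem of_le {c : ι → ℝ≥0∞} (hF : ∀ i, MemLp (F i) p volume) (hf : MemLp f p volume)
    (hle : ∀ i, eLpNorm (fun x => F i x - f x) p volume ≤ c i) (hc : Tendsto c l (𝓝 0)) :
    LpLim p l F f :=
  ⟨hF, hf, tendsto_of_tendsto_of_tendsto_of_le_of_le tendsto_const_nhds hc (fun _ => zero_le)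
    hle⟩

theorem add (hp : 1 ≤ p) (hF : LpLim p l F f) (hG : LpLim p l G g) :
    LpLim p l (fun i x => F i x + G i x) (fun x => f x + g x) := by
  refine of_le (fun i => (hF.memLp i).add (hG.memLp i)) (hF.memLp_lim.add hG.memLp_lim)
    (fun i => ?_) (by simpa using hF.tendsto.add hG.tendsto)
  refine le_trans (le_of_eq ?_) (eLpNorm_add_le ((hF.memLp i).sub hF.memLp_lim).1
    ((hG.memLp i).sub hG.memLp_lim).1 hp)
  congr 1
  ext x
  simp only [Pi.add_apply]
  ring

theorem const_mul (hF : LpLim p l F f) (c : ℝ) :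
    LpLim p l (fun i x => c * F i x) (fun x => c * f x) := by
  refine of_le (fun i => (hF.memLp i).const_mul c) (hF.memLp_lim.const_mul c)
    (c := fun i => ‖c‖ₑ * eLpNorm (fun x => F i x - f x) p volume) (fun i => ?_) ?_
  · rw [← eLpNorm_const_smul]
    exact le_of_eq (by congr 1; ext x; simp [mul_sub])
  · simpa using ENNReal.Tendsto.const_mul hF.tendsto (Or.inr (by simp : ‖c‖ₑ ≠ ⊤))

theorem sub (hp : 1 ≤ p) (hF : LpLim p l F f) (hG : LpLim p l G g) :
    LpLim p l (fun i x => F i x - G i x) (fun x => f x - g x) := by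
  simpa [sub_eq_add_neg] using hF.add hp (hG.const_mul (-1))

theorem sum {κ : Type*} (s : Finset κ) (hp : 1 ≤ p) {F : κ → ι → E3 → ℝ} {f : κ → E3 → ℝ}
    (h : ∀ k ∈ s, LpLim p l (F k) (f k)) :
    LpLim p l (fun i x => ∑ k ∈ s, F k i x) (fun x => ∑ k ∈ s, f k x) := by
  classical
  induction s using Finset.induction_on with
  | empty => exact const (f := fun _ => (0 : ℝ)) MemLp.zero'
  | insert a s ha ih =>
    simp only [Finset.sum_insert ha]
    exact (h a (by simp)).add hp (ih fun k hk => h k (by simp [hk]))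

theorem mul (hr : 1 ≤ r) [ENNReal.HolderTriple p q r] (hF : LpLim p l F f) (hG : LpLim q l G g) :
    LpLim r l (fun i x => F i x * G i x) (fun x => f x * g x) := by
  refine of_le (fun i => (hG.memLp i).mul (hF.memLp i)) (hG.memLp_lim.mul hF.memLp_lim)
    (c := fun i => eLpNorm (fun x => F i x - f x) p volume * eLpNorm (fun x => G i x - g x) q volume
      + eLpNorm (fun x => F i x - f x) p volume * eLpNorm g q volume
      + eLpNorm f p volume * eLpNorm (fun x => G i x - g x) q volume) (fun i => ?_) ?_
  · have h1 := ((hF.memLp i).sub hF.memLp_lim)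
    have h2 := ((hG.memLp i).sub hG.memLp_lim)
    have e : (fun x => F i x * G i x - f x * g x) = ((fun x => (F i x - f x) * (G i x - g x))
      + (fun x => (F i x - f x) * g x)) + (fun x => f x * (G i x - g x)) := by
      ext x
      simp only [Pi.add_apply]
      ring
    rw [e]
    have m1 := h1.1.mul h2.1
    have m2 := h1.1.mul hG.memLp_lim.1
    have m3 := hF.memLp_lim.1.mul h2.1
    refine (eLpNorm_add_le (m1.add m2) m3 hr).trans ?_
    refine add_le_add ((eLpNorm_add_le m1 m2 hr).trans ?_) (eLpNorm_mul_le hF.memLp_lim.1 h2.1)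
    exact add_le_add (eLpNorm_mul_le h1.1 h2.1) (eLpNorm_mul_le h1.1 hG.memLp_lim.1)
  · have a1 := ENNReal.Tendsto.mul hF.tendsto (Or.inr (by simp)) hG.tendsto (Or.inr (by simp))
    have a2 := ENNReal.Tendsto.mul_const (b := eLpNorm g q volume) hF.tendsto
      (Or.inr hG.memLp_lim.2.ne)
    have a3 := ENNReal.Tendsto.const_mul (a := eLpNorm f p volume) hG.tendsto
      (Or.inr hF.memLp_lim.2.ne)
    simpa using (a1.add a2).add a3

theorem tendsto_integral (h : LpLim 1 l F f) : Tendsto (fun i => ∫ x, F i x) l (𝓝 (∫ x, f x)) :=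
  tendsto_integral_of_L1' f h.memLp_lim.1
    (Eventually.of_forall fun i => memLp_one_iff_integrable.1 (h.memLp i)) h.tendsto

theorem tendstoInMeasure (hp : p ≠ 0) (h : LpLim p l F f) : TendstoInMeasure volume F l f :=
  tendstoInMeasure_of_tendsto_eLpNorm hp (fun i => (h.memLp i).1) h.memLp_lim.1 h.tendsto

theorem ae_unique [NeBot l] [IsCountablyGenerated l] (hp : p ≠ 0) (hq : q ≠ 0)
    (hf : LpLim p l F f) (hg : LpLim q l F g) : f =ᵐ[volume] g :=
  tendstoInMeasure_ae_unique (hf.tendstoInMeasure hp) (hg.tendstoInMeasure hq)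

theorem tendsto_eLpNorm (hp : 1 ≤ p) (h : LpLim p l F f) :
    Tendsto (fun i => eLpNorm (F i) p volume) l (𝓝 (eLpNorm f p volume)) := by
  have key : ∀ i, eLpNorm (F i) p volume ≤
      eLpNorm f p volume + eLpNorm (fun x => F i x - f x) p volume := fun i => by
    refine le_trans (le_of_eq ?_) (eLpNorm_add_le h.memLp_lim.1 ((h.memLp i).sub h.memLp_lim).1 hp)
    congr 1
    ext x
    simp
  have key' : ∀ i, eLpNorm f p volume - eLpNorm (fun x => F i x - f x) p volume ≤
      eLpNorm (F i) p volume := fun i => by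
    rw [tsub_le_iff_right]
    have := eLpNorm_sub_le (h.memLp i).1 ((h.memLp i).sub h.memLp_lim).1 hp
    refine le_trans (le_of_eq ?_) this
    congr 1
    ext x
    simp
  refine tendsto_of_tendsto_of_tendsto_of_le_of_le ?_ ?_ key' key
  · simpa using ENNReal.Tendsto.sub (tendsto_const_nhds (x := eLpNorm f p volume)) h.tendsto
      (Or.inr (by simp))
  · simpa using (tendsto_const_nhds (x := eLpNorm f p volume)).add h.tendsto

/-- Lower semicontinuity of the `L^q` norm under convergence in another `L^p`. -/
theorem eLpNorm_le_of_tendsto (hp : p ≠ 0) {F : ℕ → E3 → ℝ} (h : LpLim p atTop F f)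
    {c : ℕ → ℝ≥0∞} {c' : ℝ≥0∞} (hc : ∀ n, eLpNorm (F n) q volume ≤ c n)
    (hc' : Tendsto c atTop (𝓝 c')) : eLpNorm f q volume ≤ c' := by
  obtain ⟨ns, hns, hae⟩ := (h.tendstoInMeasure hp).exists_seq_tendsto_ae
  refine (Lp.eLpNorm_lim_le_liminf_eLpNorm (fun n => (h.memLp (ns n)).1) f hae).trans ?_
  refine (liminf_le_liminf (Eventually.of_forall fun n => hc (ns n))).trans_eq ?_
  exact (hc'.comp hns.tendsto_atTop).liminf_eq

end LpLim

theorem abs_rpow_sub_rpow_le {x y b : ℝ} (hx : 0 ≤ x) (hy : 0 ≤ y) (hb : 1 ≤ b) :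
    |x ^ b - y ^ b| ≤ b * (|x - y| * (x + y) ^ (b - 1)) := by
  have := Convex.norm_image_sub_le_of_norm_hasDerivWithin_le (f := fun t : ℝ => t ^ b)
    (f' := fun t => b * t ^ (b - 1)) (s := Set.Icc 0 (x + y)) (C := b * (x + y) ^ (b - 1))
    (fun t _ => (Real.hasDerivAt_rpow_const (Or.inr hb)).hasDerivWithinAt)
    (fun t ht => by
      have h0 : 0 ≤ b * t ^ (b - 1) := mul_nonneg (by linarith) (Real.rpow_nonneg ht.1 _)
      rw [Real.norm_of_nonneg h0]
      exact mul_le_mul_of_nonneg_left (Real.rpow_le_rpow ht.1 ht.2 (by linarith)) (by linarith))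
    (convex_Icc _ _) (x := y) (y := x) ⟨hy, by linarith⟩ ⟨hx, by linarith⟩
  simp only [Real.norm_eq_abs] at this
  linarith

theorem memLp_rpow_of_nonneg {a b c : ℝ} (hb : 0 < b) (hc : c = a / b)
    {f : E3 → ℝ} (hf : MemLp f (ENNReal.ofReal a) volume) (h0 : ∀ x, 0 ≤ f x) :
    MemLp (fun x => f x ^ b) (ENNReal.ofReal c) volume := by
  have := hf.norm_rpow_div (ENNReal.ofReal b)
  rw [← ENNReal.ofReal_div_of_pos hb, ← hc] at this
  simpa [ENNReal.toReal_ofReal hb.le, abs_of_nonneg (h0 _)] using this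

/-- Nemytskii continuity: `F i → f` in `L^a` implies `(F i)^b → f^b` in `L^{a/b}`. -/
theorem LpLim.rpow {ι : Type*} {l : Filter ι} {a b c : ℝ} (hb : 1 < b) (hab : b ≤ a)
    (hc : c = a / b)
    {F : ι → E3 → ℝ} {f : E3 → ℝ} (h : LpLim (ENNReal.ofReal a) l F f)
    (hF0 : ∀ i x, 0 ≤ F i x) (hf0 : ∀ x, 0 ≤ f x) :
    LpLim (ENNReal.ofReal c) l (fun i x => F i x ^ b) (fun x => f x ^ b) := by
  have ha : 0 < a := by linarith
  have hc0 : 0 < c := hc ▸ by positivity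
  have hd : 0 < a / (b - 1) := div_pos ha (by linarith)
  have a1 : (1 : ℝ≥0∞) ≤ ENNReal.ofReal a := by
    rw [← ENNReal.ofReal_one]
    exact ENNReal.ofReal_le_ofReal (by linarith)
  have hol : ENNReal.HolderTriple (ENNReal.ofReal a) (ENNReal.ofReal (a / (b - 1)))
      (ENNReal.ofReal c) := holderTriple_ofReal ha hd hc0 (by
        rw [hc]
        field_simp
        ring)
  have hS : LpLim (ENNReal.ofReal a) l (fun i x => F i x + f x) (fun x => f x + f x) :=
    h.add a1 (LpLim.const h.memLp_lim)
  refine LpLim.of_le (fun i => memLp_rpow_of_nonneg (by linarith) hc (h.memLp i) (hF0 i))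
    (memLp_rpow_of_nonneg (by linarith) hc h.memLp_lim hf0)
    (c := fun i => ‖b‖ₑ * (eLpNorm (fun x => F i x - f x) (ENNReal.ofReal a) volume *
      (eLpNorm (fun x => F i x + f x) (ENNReal.ofReal a) volume) ^ (b - 1))) (fun i => ?_) ?_
  · have m1 := ((h.memLp i).sub h.memLp_lim)
    have m2 := memLp_rpow_of_nonneg (c := a / (b - 1)) (by linarith : 0 < b - 1) rfl
      (hS.memLp i) (fun x => add_nonneg (hF0 i x) (hf0 x))
    have e2 : eLpNorm (fun x => (F i x + f x) ^ (b - 1)) (ENNReal.ofReal (a / (b - 1))) volume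
        = (eLpNorm (fun x => F i x + f x) (ENNReal.ofReal a) volume) ^ (b - 1) := by
      have := eLpNorm_norm_rpow (p := ENNReal.ofReal (a / (b - 1))) (μ := volume)
        (fun x => F i x + f x) (by linarith : 0 < b - 1)
      rw [← ENNReal.ofReal_mul hd.le, div_mul_cancel₀ _ (by linarith : b - 1 ≠ 0)] at this
      rw [← this]
      congr 1
      ext x
      rw [Real.norm_of_nonneg (add_nonneg (hF0 i x) (hf0 x))]
    rw [← e2]
    calc _ ≤ eLpNorm (fun x => b * ((F i x - f x) * (F i x + f x) ^ (b - 1)))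
          (ENNReal.ofReal c) volume := by
          refine eLpNorm_mono fun x => ?_
          have h0 := add_nonneg (hF0 i x) (hf0 x)
          rw [Real.norm_eq_abs, norm_mul, norm_mul, Real.norm_of_nonneg (by linarith : 0 ≤ b),
            Real.norm_of_nonneg (Real.rpow_nonneg h0 _)]
          exact abs_rpow_sub_rpow_le (hF0 i x) (hf0 x) hb.le
      _ = ‖b‖ₑ * eLpNorm (fun x => (F i x - f x) * (F i x + f x) ^ (b - 1))
          (ENNReal.ofReal c) volume := eLpNorm_const_smul b _ _ _
      _ ≤ _ := by
        gcongr
        exact eLpNorm_mul_le m1.1 m2.1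
  · have t1 : Tendsto 
        (fun i => (eLpNorm (fun x => F i x + f x) (ENNReal.ofReal a) volume) ^ (b - 1)) l (𝓝 ((eLpNorm (fun x => f x + f x) (ENNReal.ofReal a) volume) ^ (b - 1))) :=
      (ENNReal.continuous_rpow_const.tendsto _).comp (hS.tendsto_eLpNorm a1)
    have ht : (eLpNorm (fun x => f x + f x) (ENNReal.ofReal a) volume) ^ (b - 1) ≠ ⊤ :=
      ENNReal.rpow_ne_top_of_nonneg (by linarith) hS.memLp_lim.2.ne
    have := ENNReal.Tendsto.const_mul (a := ‖b‖ₑ) (ENNReal.Tendsto.mul h.tendsto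
      (Or.inr ht) t1 (Or.inr (by simp))) (Or.inr (by simp))
    simpa using this

/-- `L^a ∩ L^∞ ⊆ L^b` for `a ≤ b`. -/
theorem memLp_of_bounded_of_le {a b : ℝ≥0∞} {f : E3 → ℝ} (ha : a ≠ 0) (ha' : a ≠ ⊤)
    (hab : a ≤ b) (hb : b ≠ ⊤)
    (hf : MemLp f a volume) {C : ℝ} (hC : ∀ x, |f x| ≤ C) : MemLp f b volume := by
  have hb0 : b ≠ 0 := (lt_of_lt_of_le (pos_iff_ne_zero.2 ha) hab).ne'
  have h1 : 0 < a.toReal := ENNReal.toReal_pos ha ha'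
  have h2 : a.toReal ≤ b.toReal := ENNReal.toReal_mono hb hab
  have hi := hf.integrable_norm_rpow ha ha'
  refine (integrable_norm_rpow_iff hf.1 hb0 hb).1 ?_
  refine Integrable.mono' (hi.const_mul (C ^ (b.toReal - a.toReal)))
    (hf.1.norm.aemeasurable.pow_const _).aestronglyMeasurable (Eventually.of_forall fun x => ?_)
  have : ‖f x‖ ^ b.toReal = ‖f x‖ ^ (b.toReal - a.toReal) * ‖f x‖ ^ a.toReal := by
    rw [← Real.rpow_add_of_nonneg (norm_nonneg _) (by linarith) h1.le]
    simp
  rw [Real.norm_of_nonneg (Real.rpow_nonneg (norm_nonneg _) _), this]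
  gcongr
  exact hC x

/-- Interpolation: `L^a ∩ L^b ⊆ L^r` for `a ≤ r ≤ b`. -/
theorem memLp_of_le_of_le {a r b : ℝ≥0∞} {f : E3 → ℝ} (ha : a ≠ 0)
    (har : a ≤ r) (hrb : r ≤ b) (hb : b ≠ ⊤)
    (hf : MemLp f a volume) (hg : MemLp f b volume) : MemLp f r volume := by
  have hr : r ≠ ⊤ := (hrb.trans_lt hb.lt_top).ne
  have hr0 : r ≠ 0 := (lt_of_lt_of_le (pos_iff_ne_zero.2 ha) har).ne'
  have hb0 : b ≠ 0 := (lt_of_lt_of_le (pos_iff_ne_zero.2 hr0) hrb).ne'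
  have ha' : a ≠ ⊤ := (har.trans_lt hr.lt_top).ne
  have h1 : 0 < a.toReal := ENNReal.toReal_pos ha ha'
  have h2 : a.toReal ≤ r.toReal := ENNReal.toReal_mono hr har
  have h3 : r.toReal ≤ b.toReal := ENNReal.toReal_mono hb hrb
  refine (integrable_norm_rpow_iff hf.1 hr0 hr).1 ?_
  refine Integrable.mono' ((hf.integrable_norm_rpow ha ha').add (hg.integrable_norm_rpow hb0 hb))
    (hf.1.norm.aemeasurable.pow_const _).aestronglyMeasurable (Eventually.of_forall fun x => ?_)
  rw [Real.norm_of_nonneg (Real.rpow_nonneg (norm_nonneg _) _), Pi.add_apply]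
  have p1 := Real.rpow_nonneg (norm_nonneg (f x)) a.toReal
  have p2 := Real.rpow_nonneg (norm_nonneg (f x)) b.toReal
  rcases le_total ‖f x‖ 1 with h | h
  · have := Real.rpow_le_rpow_of_exponent_ge' (norm_nonneg _) h h1.le h2
    linarith
  · have := Real.rpow_le_rpow_of_exponent_le h h3
    linarith

/-! ### Partial derivatives, test functions and `D₀^{1,2}` -/

/-- The classical partial derivative `∂ᵢ f`. -/
noncomputable def pd (i : Fin 3) (f : E3 → ℝ) (x : E3) : ℝ := gradient f x i

theorem pd_eq_fderiv (i : Fin 3) (f : E3 → ℝ) (x : E3) :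
    pd i f x = fderiv ℝ f x (EuclideanSpace.single i 1) := by
  rw [pd, gradient, ← InnerProductSpace.toDual_symm_apply, EuclideanSpace.inner_single_right]
  simp

theorem fderiv_apply_eq_sum_pd (f : E3 → ℝ) (x v : E3) :
    fderiv ℝ f x v = ∑ i, v i * pd i f x := by
  conv_lhs => rw [← (EuclideanSpace.basisFun (Fin 3) ℝ).sum_repr v]
  simp [pd_eq_fderiv]

theorem pd_funext (i : Fin 3) (f : E3 → ℝ) :
    pd i f = fun x => fderiv ℝ f x (EuclideanSpace.single i 1) := funext (pd_eq_fderiv i f)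

theorem HasFDerivAt.pd_eq {f : E3 → ℝ} {f' : E3 →L[ℝ] ℝ} {x : E3} (h : HasFDerivAt f f' x)
    (i : Fin 3) : pd i f x = f' (EuclideanSpace.single i 1) := by
  rw [pd_eq_fderiv, h.fderiv]

theorem ContDiff.pd {m n : WithTop ℕ∞} {f : E3 → ℝ} (hf : ContDiff ℝ n f) (hmn : m + 1 ≤ n)
    (i : Fin 3) : ContDiff ℝ m (pd i f) := by
  rw [pd_funext]
  exact (hf.fderiv_right hmn).clm_apply contDiff_const

theorem HasCompactSupport.pd {f : E3 → ℝ} (hf : HasCompactSupport f) (i : Fin 3) :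
    HasCompactSupport (pd i f) := by
  rw [pd_funext]
  exact hf.fderiv_apply (𝕜 := ℝ) _

theorem pd_mul {f g : E3 → ℝ} (hf : Differentiable ℝ f) (hg : Differentiable ℝ g) (i : Fin 3)
    (x : E3) : pd i (fun y => f y * g y) x = f x * pd i g x + pd i f x * g x := by
  rw [pd_eq_fderiv, fderiv_fun_mul (hf x) (hg x)]
  simp [pd_eq_fderiv, mul_comm]

theorem pd_add {f g : E3 → ℝ} (hf : Differentiable ℝ f) (hg : Differentiable ℝ g) (i : Fin 3)
    (x : E3) : pd i (fun y => f y + g y) x = pd i f x + pd i g x := by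
  rw [pd_eq_fderiv, fderiv_fun_add (hf x) (hg x)]
  simp [pd_eq_fderiv]

theorem pd_const_mul {f : E3 → ℝ} (hf : Differentiable ℝ f) (c : ℝ) (i : Fin 3)
    (x : E3) : pd i (fun y => c * f y) x = c * pd i f x := by
  rw [((hf x).hasFDerivAt.const_mul c).pd_eq]
  simp [pd_eq_fderiv]

theorem pd_comm {f : E3 → ℝ} (hf : ContDiff ℝ 2 f) (i j : Fin 3) (x : E3) :
    pd i (pd j f) x = pd j (pd i f) x := by
  have h : ∀ v w : E3, fderiv ℝ (fun y => fderiv ℝ f y v) x w = fderiv ℝ (fderiv ℝ f) x w v := by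
    intro v w
    have hd : DifferentiableAt ℝ (fderiv ℝ f) x :=
      ((hf.fderiv_right (m := 1) (by norm_num)).differentiable (by norm_num)) x
    rw [fderiv_clm_apply hd (by fun_prop)]
    simp
  rw [pd_funext j f, pd_funext i f, pd_eq_fderiv, pd_eq_fderiv, h, h]
  have := (hf.contDiffAt (x := x)).isSymmSndFDerivAt (by simp)
  exact this _ _

namespace IsTestFunction

variable {φ ψ : E3 → ℝ}

theorem contDiff' (h : IsTestFunction φ) {n : ℕ} : ContDiff ℝ n φ :=
  h.1.of_le (by exact_mod_cast le_top)

theorem differentiable (h : IsTestFunction φ) : Differentiable ℝ φ :=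
  h.1.differentiable (by simp)

theorem continuous (h : IsTestFunction φ) : Continuous φ := h.1.continuous

theorem pd (h : IsTestFunction φ) (i : Fin 3) : IsTestFunction (pd i φ) :=
  ⟨h.1.pd (by simp) i, h.2.pd i⟩

theorem add (hφ : IsTestFunction φ) (hψ : IsTestFunction ψ) :
    IsTestFunction (fun x => φ x + ψ x) := ⟨hφ.1.add hψ.1, hφ.2.add hψ.2⟩

theorem mul (hφ : IsTestFunction φ) (hψ : IsTestFunction ψ) :
    IsTestFunction (fun x => φ x * ψ x) := ⟨hφ.1.mul hψ.1, hφ.2.mul_right⟩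

theorem const_mul (hφ : IsTestFunction φ) (c : ℝ) : IsTestFunction (fun x => c * φ x) :=
  ⟨contDiff_const.mul hφ.1, hφ.2.mul_left⟩

theorem sub (hφ : IsTestFunction φ) (hψ : IsTestFunction ψ) :
    IsTestFunction (fun x => φ x - ψ x) := by
  simpa [sub_eq_add_neg] using hφ.add (hψ.const_mul (-1))

theorem sum {κ : Type*} (s : Finset κ) {φ : κ → E3 → ℝ} (h : ∀ k ∈ s, IsTestFunction (φ k)) :
    IsTestFunction (fun x => ∑ k ∈ s, φ k x) := by
  classical
  induction s using Finset.induction_on with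
  | empty => exact ⟨by simpa using contDiff_const, by simp [HasCompactSupport, tsupport]⟩
  | insert a s ha ih =>
    simp only [Finset.sum_insert ha]
    exact (h a (by simp)).add (ih fun k hk => h k (by simp [hk]))

theorem memLp (h : IsTestFunction φ) (p : ℝ≥0∞) : MemLp φ p volume :=
  h.continuous.memLp_of_hasCompactSupport h.2

theorem integrable (h : IsTestFunction φ) : Integrable φ :=
  h.continuous.integrable_of_hasCompactSupport h.2

end IsTestFunction

theorem pd_sub {f g : E3 → ℝ} (hf : Differentiable ℝ f) (hg : Differentiable ℝ g) (i : Fin 3)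
    (x : E3) : pd i (fun y => f y - g y) x = pd i f x - pd i g x := by
  rw [pd_eq_fderiv, fderiv_fun_sub (hf x) (hg x)]
  simp [pd_eq_fderiv]

/-- Integration by parts, with compact support required of one factor only. -/
theorem integral_mul_pd {f g : E3 → ℝ} (hf : ContDiff ℝ 1 f) (hg : ContDiff ℝ 1 g)
    (hc : HasCompactSupport g) (i : Fin 3) :
    ∫ x, f x * pd i g x = - ∫ x, pd i f x * g x := by
  have cf : Continuous (pd i f) := (hf.pd (m := 0) (by simp) i).continuous
  have cg : Continuous (pd i g) := (hg.pd (m := 0) (by simp) i).continuous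
  have := integral_mul_fderiv_eq_neg_fderiv_mul_of_integrable (μ := (volume : Measure E3))
    (f := f) (g := g) (v := EuclideanSpace.single i 1)
    (by
      simp only [← pd_eq_fderiv]
      exact (cf.mul hg.continuous).integrable_of_hasCompactSupport hc.mul_left)
    (by
      simp only [← pd_eq_fderiv]
      exact (hf.continuous.mul cg).integrable_of_hasCompactSupport (hc.pd i).mul_left)
    ((hf.continuous.mul hg.continuous).integrable_of_hasCompactSupport hc.mul_left)
    (fun x _ => hf.differentiable (by simp) x) (fun x _ => hg.differentiable (by simp) x)
  simpa only [pd_eq_fderiv] using this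

/-- Two integrations by parts exchange the derivatives: `∫ ∂ᵢφ ∂ⱼψ = ∫ ∂ⱼφ ∂ᵢψ`. -/
theorem integral_pd_mul_pd_comm {φ ψ : E3 → ℝ} (hφ : IsTestFunction φ) (hψ : IsTestFunction ψ)
    (i j : Fin 3) : ∫ x, pd i φ x * pd j ψ x = ∫ x, pd j φ x * pd i ψ x := by
  have h1 := integral_mul_pd (hφ.pd i).contDiff' hψ.contDiff' hψ.2 j
  have h2 := integral_mul_pd (hφ.pd j).contDiff' hψ.contDiff' hψ.2 i
  rw [h1, h2]
  simp only [pd_comm hφ.contDiff' i j]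

theorem eLpNorm_fderiv_le {φ : E3 → ℝ} (hφ : IsTestFunction φ) {p : ℝ≥0∞} (hp : 1 ≤ p) :
    eLpNorm (fderiv ℝ φ) p volume ≤ ∑ i, eLpNorm (pd i φ) p volume := by
  calc eLpNorm (fderiv ℝ φ) p volume ≤ eLpNorm (∑ i, fun x => ‖pd i φ x‖) p volume := by
        refine eLpNorm_mono_real fun x => ?_
        refine ContinuousLinearMap.opNorm_le_bound _ (by simp [Finset.sum_nonneg]) fun v => ?_
        rw [fderiv_apply_eq_sum_pd, Finset.sum_apply, Finset.sum_mul]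
        refine (norm_sum_le _ _).trans (Finset.sum_le_sum fun i _ => ?_)
        rw [norm_mul, mul_comm]
        gcongr
        exact PiLp.norm_apply_le v i
    _ ≤ ∑ i, eLpNorm (fun x => ‖pd i φ x‖) p volume :=
        eLpNorm_sum_le (fun i _ => (hφ.pd i).continuous.norm.aestronglyMeasurable) hp
    _ = _ := by simp only [eLpNorm_norm]

/-- Sobolev's inequality `‖φ‖₆ ≤ C ‖∇φ‖₂` in `ℝ³`. -/
theorem exists_eLpNorm_six_le : ∃ C : ℝ≥0∞, C ≠ ⊤ ∧ ∀ φ : E3 → ℝ, IsTestFunction φ →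
    eLpNorm φ 6 volume ≤ C * ∑ i, eLpNorm (pd i φ) 2 volume := by
  refine ⟨SNormLESNormFDerivOfEqConst ℝ (volume : Measure E3) 2, by simp, fun φ hφ => ?_⟩
  have := eLpNorm_le_eLpNorm_fderiv_of_eq (volume : Measure E3) (p := 2) (p' := 6)
    hφ.contDiff' hφ.2 (by norm_num) (by simp) (by simp; norm_num)
  refine le_trans (by exact_mod_cast this) ?_
  gcongr
  exact eLpNorm_fderiv_le hφ (by norm_num)

/-- `φ n` are test functions with `φ n → f` in `L⁶` and `∂ₖ (φ n) → g k` in `L²`: the form in which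
membership of `f` in `D₀^{1,2}(ℝ³)`, with weak gradient `g`, is used. -/
structure D12Approx (φ : ℕ → E3 → ℝ) (f : E3 → ℝ) (g : Fin 3 → E3 → ℝ) : Prop where
  test : ∀ n, IsTestFunction (φ n)
  lim : LpLim 6 atTop φ f
  lim_pd : ∀ k, LpLim 2 atTop (fun n => pd k (φ n)) (g k)

theorem memLp_apply {p : ℝ≥0∞} {g : E3 → E3} (hg : MemLp g p volume) (k : Fin 3) :
    MemLp (fun x => g x k) p volume :=
  (EuclideanSpace.proj (𝕜 := ℝ) k).comp_memLp' hg

theorem MemD10.exists_lpLim_pd {q : ℝ≥0∞} {f : E3 → ℝ} (h : MemD10 q f) :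
    ∃ φ : ℕ → E3 → ℝ, (∀ n, IsTestFunction (φ n)) ∧
      (∀ k, LpLim q atTop (fun n => pd k (φ n)) (fun x => weakGradient f x k)) ∧
      ∀ K : Set E3, IsCompact K →
        Tendsto (fun n => eLpNorm (fun x => φ n x - f x) 1 (volume.restrict K)) atTop (𝓝 0) := by
  obtain ⟨-, hg, φ, hφ, hlim, hloc⟩ := h
  refine ⟨φ, hφ, fun k => LpLim.of_le (fun n => ((hφ n).pd k).memLp q) (memLp_apply hg k)
    (fun n => ?_) hlim, hloc⟩
  refine eLpNorm_mono fun x => ?_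
  exact PiLp.norm_apply_le (gradient (φ n) x - weakGradient f x) k

/-- A function in `D₀^{1,2}(ℝ³)` belongs to `L⁶`, and the approximating test functions converge to
it there: they are Cauchy in `L⁶` by Sobolev's inequality, and the `L¹_loc` limit identifies `f`. -/
theorem MemD10.exists_d12Approx {f : E3 → ℝ} (h : MemD10 2 f) :
    ∃ φ, D12Approx φ f (fun k x => weakGradient f x k) := by
  obtain ⟨φ, hφ, hpd, hloc⟩ := h.exists_lpLim_pd
  refine ⟨φ, hφ, ?_, hpd⟩
  obtain ⟨C, hC, hS⟩ := exists_eLpNorm_six_le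
  have hf : LocallyIntegrable f volume := h.1.locallyIntegrable
  set d : ℕ → ℝ≥0∞ := fun n =>
    C * ∑ k, eLpNorm (fun x => pd k (φ n) x - weakGradient f x k) 2 volume with hd
  have hd0 : Tendsto d atTop (𝓝 0) := by
    have := ENNReal.Tendsto.const_mul (a := C)
      (tendsto_finsetSum Finset.univ fun k _ => (hpd k).tendsto) (Or.inr hC)
    simpa using this
  have hcau : ∀ n m, eLpNorm (fun x => φ n x - φ m x) 6 volume ≤ d n + d m := fun n m => by
    refine (hS _ ((hφ n).sub (hφ m))).trans ?_
    rw [hd, ← mul_add, ← Finset.sum_add_distrib]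
    gcongr with k
    refine le_trans (le_of_eq ?_) (eLpNorm_sub_le (((hpd k).memLp n).sub (hpd k).memLp_lim).1
      (((hpd k).memLp m).sub (hpd k).memLp_lim).1 (by norm_num))
    congr 1
    ext x
    rw [pd_sub (hφ n).differentiable (hφ m).differentiable]
    simp
  obtain ⟨g, hg⟩ : ∃ g, LpLim 6 atTop φ g := by
    have : Fact ((1 : ℝ≥0∞) ≤ 6) := ⟨by norm_num⟩
    have hc : CauchySeq fun n => ((hφ n).memLp 6).toLp (φ n) := by
      rw [Lp.cauchySeq_Lp_iff_cauchySeq_eLpNorm]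
      refine tendsto_of_tendsto_of_tendsto_of_le_of_le tendsto_const_nhds
        (h := fun n : ℕ × ℕ => d n.1 + d n.2) ?_ (fun _ => zero_le) fun n => ?_
      · have := (hd0.comp tendsto_fst).add (hd0.comp tendsto_snd)
        rw [prod_atTop_atTop_eq] at this
        simpa using this
      · refine le_trans (le_of_eq (eLpNorm_congr_ae ?_)) (hcau n.1 n.2)
        exact ((hφ n.1).memLp 6).coeFn_toLp.sub ((hφ n.2).memLp 6).coeFn_toLp
    obtain ⟨g, hg⟩ := cauchySeq_tendsto_of_complete hc
    refine ⟨g, fun n => (hφ n).memLp 6, Lp.memLp g, ?_⟩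
    rw [Lp.tendsto_Lp_iff_tendsto_eLpNorm'] at hg
    refine hg.congr fun n => eLpNorm_congr_ae ?_
    exact ((hφ n).memLp 6).coeFn_toLp.sub (ae_eq_refl _)
  refine hg.congr_lim ?_
  have hball : ∀ R : ℕ, ∀ᵐ x ∂(volume.restrict (Metric.closedBall (0 : E3) R)), g x = f x := by
    intro R
    have hK := isCompact_closedBall (0 : E3) R
    have m1 : TendstoInMeasure (volume.restrict (Metric.closedBall (0 : E3) R)) φ atTop f :=
      tendstoInMeasure_of_tendsto_eLpNorm one_ne_zero
        (fun n => (hφ n).continuous.aestronglyMeasurable)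
        (hf.integrableOn_isCompact hK).aestronglyMeasurable (hloc _ hK)
    have m2 : TendstoInMeasure (volume.restrict (Metric.closedBall (0 : E3) R)) φ atTop g := by
      refine tendstoInMeasure_of_tendsto_eLpNorm (p := 6) (by norm_num)
        (fun n => (hφ n).continuous.aestronglyMeasurable) hg.memLp_lim.1.restrict ?_
      exact tendsto_of_tendsto_of_tendsto_of_le_of_le tendsto_const_nhds hg.tendsto
        (fun _ => zero_le) (fun n => eLpNorm_mono_measure _ Measure.restrict_le_self)
    exact tendstoInMeasure_ae_unique m2 m1
  have := ae_all_iff.2 fun R => (ae_restrict_iff' measurableSet_closedBall).1 (hball R)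
  filter_upwards [this] with x hx
  obtain ⟨R, hR⟩ := exists_nat_ge ‖x‖
  exact hx R (by simpa using hR)

/-- By Sobolev's inequality, a `D₀^{1,2}` function with vanishing gradient vanishes. -/
theorem D12Approx.ae_eq_zero {φ : ℕ → E3 → ℝ} {f : E3 → ℝ} {g : Fin 3 → E3 → ℝ}
    (h : D12Approx φ f g) (hg : ∀ k, g k =ᵐ[volume] 0) : f =ᵐ[volume] 0 := by
  obtain ⟨C, hC, hS⟩ := exists_eLpNorm_six_le
  have h0 : eLpNorm f 6 volume ≤ 0 := by
    refine h.lim.eLpNorm_le_of_tendsto (by norm_num) (fun n => hS _ (h.test n)) ?_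
    have := ENNReal.Tendsto.const_mul (a := C) (tendsto_finsetSum Finset.univ fun k _ =>
      (h.lim_pd k).tendsto_eLpNorm (by norm_num)) (Or.inr hC)
    simpa [eLpNorm_congr_ae (hg _)] using this
  exact (eLpNorm_eq_zero_iff h.lim.memLp_lim.1 (by norm_num)).1 (le_antisymm h0 zero_le)

/-! ### Translations, convolutions and mollification -/

/-- The shear `(x, z) ↦ x - T z` pulls null sets back to null sets; this makes `f (x - T z)` jointly
measurable for `f` that is only a.e. measurable. -/
theorem quasiMeasurePreserving_sub_comp {Z : Type*} [MeasurableSpace Z] (ν : Measure Z) [SFinite ν]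
    {T : Z → E3} (hT : Measurable T) :
    Measure.QuasiMeasurePreserving (fun p : E3 × Z => p.1 - T p.2)
      ((volume : Measure E3).prod ν) volume := by
  have hm : Measurable fun p : E3 × Z => p.1 - T p.2 := by fun_prop
  refine ⟨hm, Measure.AbsolutelyContinuous.mk fun s hs h0 => ?_⟩
  rw [Measure.map_apply hm hs, Measure.prod_apply_symm (hm hs)]
  have : ∀ z, volume ((fun x => (x, z)) ⁻¹' ((fun p : E3 × Z => p.1 - T p.2) ⁻¹' s)) = 0 :=
    fun z => ((measurePreserving_sub_right volume (T z)).measure_preimage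
      hs.nullMeasurableSet).trans h0
  simp [this]

theorem eLpNorm_rpow_toReal {Y : Type*} [MeasurableSpace Y] {m : Measure Y} {f : Y → ℝ}
    {p : ℝ≥0∞} (hp : p ≠ 0) (hp' : p ≠ ⊤) :
    (eLpNorm f p m) ^ p.toReal = ∫⁻ y, ‖f y‖ₑ ^ p.toReal ∂m := by
  rw [eLpNorm_eq_lintegral_rpow_enorm_toReal hp hp', ← ENNReal.rpow_mul]
  simp [(ENNReal.toReal_pos hp hp').ne']

/-- Minkowski's integral inequality, for a finite measure and with a uniform bound. -/
theorem eLpNorm_integral_le {Z : Type*} [MeasurableSpace Z] {ν : Measure Z} [IsFiniteMeasure ν]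
    {p : ℝ≥0∞} (hp : 1 ≤ p) (hp' : p ≠ ⊤) {F : E3 → Z → ℝ}
    (hF : AEStronglyMeasurable (Function.uncurry F) ((volume : Measure E3).prod ν)) {c : ℝ≥0∞}
    (hc : ∀ᵐ z ∂ν, eLpNorm (fun x => F x z) p volume ≤ c) :
    eLpNorm (fun x => ∫ z, F x z ∂ν) p volume ≤ ν Set.univ * c := by
  have hp0 : p ≠ 0 := (zero_lt_one.trans_le hp).ne'
  have hpp : 0 < p.toReal := ENNReal.toReal_pos hp0 hp'
  have hp1 : 1 ≤ p.toReal := by simpa using ENNReal.toReal_mono hp' hp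
  set V := ν Set.univ with hV
  rw [← ENNReal.rpow_le_rpow_iff hpp, eLpNorm_rpow_toReal hp0 hp',
    ENNReal.mul_rpow_of_nonneg _ _ hpp.le]
  have hsec : ∀ᵐ x : E3, AEStronglyMeasurable (F x) ν := hF.prodMk_left
  have h1 : ∀ᵐ x : E3, ‖∫ z, F x z ∂ν‖ₑ ^ p.toReal ≤
      (∫⁻ z, ‖F x z‖ₑ ^ p.toReal ∂ν) * V ^ (p.toReal - 1) := by
    filter_upwards [hsec] with x hx
    have := eLpNorm_le_eLpNorm_mul_rpow_measure_univ (μ := ν) (f := F x) hp hx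
    rw [eLpNorm_one_eq_lintegral_enorm] at this
    have := ENNReal.rpow_le_rpow ((enorm_integral_le_lintegral_enorm _).trans this) hpp.le
    rw [ENNReal.mul_rpow_of_nonneg _ _ hpp.le, eLpNorm_rpow_toReal hp0 hp',
      ← ENNReal.rpow_mul] at this
    refine this.trans_eq ?_
    congr 2
    simp
    field_simp
  calc ∫⁻ x : E3, ‖∫ z, F x z ∂ν‖ₑ ^ p.toReal
      ≤ ∫⁻ x : E3, (∫⁻ z, ‖F x z‖ₑ ^ p.toReal ∂ν) * V ^ (p.toReal - 1) := lintegral_mono_ae h1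
    _ = (∫⁻ x : E3, ∫⁻ z, ‖F x z‖ₑ ^ p.toReal ∂ν) * V ^ (p.toReal - 1) := by
        rw [lintegral_mul_const']
        exact ENNReal.rpow_ne_top_of_nonneg (by linarith) (measure_ne_top _ _)
    _ = (∫⁻ z, (∫⁻ x : E3, ‖F x z‖ₑ ^ p.toReal) ∂ν) * V ^ (p.toReal - 1) := by
        rw [lintegral_lintegral_swap]
        exact hF.enorm.pow_const _
    _ ≤ (∫⁻ _z, c ^ p.toReal ∂ν) * V ^ (p.toReal - 1) := by
        gcongr 1
        refine lintegral_mono_ae ?_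
        filter_upwards [hc] with z hz
        rw [← eLpNorm_rpow_toReal hp0 hp']
        exact ENNReal.rpow_le_rpow hz hpp.le
    _ = V ^ p.toReal * c ^ p.toReal := by
        rw [lintegral_const, ← hV, mul_assoc, mul_comm]
        congr 1
        rcases eq_or_ne V 0 with h | h
        · simp [h, hpp]
        · nth_rw 1 [← ENNReal.rpow_one V]
          rw [← ENNReal.rpow_add _ _ h (by simp [hV])]
          simp

/-- Almost all sections of a function as in `eLpNorm_integral_le` are integrable. -/
theorem ae_integrable_of_eLpNorm_le {Z : Type*} [MeasurableSpace Z] {ν : Measure Z}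
    [IsFiniteMeasure ν] {p : ℝ≥0∞} (hp : 1 ≤ p) (hp' : p ≠ ⊤) {F : E3 → Z → ℝ}
    (hF : AEStronglyMeasurable (Function.uncurry F) ((volume : Measure E3).prod ν)) {c : ℝ≥0∞}
    (hct : c ≠ ⊤) (hc : ∀ᵐ z ∂ν, eLpNorm (fun x => F x z) p volume ≤ c) :
    ∀ᵐ x : E3, Integrable (F x) ν := by
  have hp0 : p ≠ 0 := (zero_lt_one.trans_le hp).ne'
  have hpp : 0 < p.toReal := ENNReal.toReal_pos hp0 hp'
  have hm : AEMeasurable (fun q : E3 × Z => ‖F q.1 q.2‖ₑ ^ p.toReal)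
    ((volume : Measure E3).prod ν) := hF.enorm.pow_const _
  have hfin : ∫⁻ x : E3, ∫⁻ z, ‖F x z‖ₑ ^ p.toReal ∂ν ≠ ⊤ := by
    rw [lintegral_lintegral_swap hm]
    refine ne_top_of_le_ne_top (b := ∫⁻ _z, c ^ p.toReal ∂ν) ?_ (lintegral_mono_ae ?_)
    · rw [lintegral_const]
      exact ENNReal.mul_ne_top (ENNReal.rpow_ne_top_of_nonneg hpp.le hct) (measure_ne_top _ _)
    · filter_upwards [hc] with z hz
      rw [← eLpNorm_rpow_toReal hp0 hp']
      exact ENNReal.rpow_le_rpow hz hpp.le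
  filter_upwards [ae_lt_top' hm.lintegral_prod_right' hfin,
    hF.prodMk_left] with x hx hmx
  rw [← eLpNorm_rpow_toReal hp0 hp'] at hx
  have : MemLp (F x) p ν := ⟨hmx, by
    by_contra h
    rw [not_lt_top_iff] at h
    simp [h, hpp] at hx⟩
  exact this.integrable hp

theorem MeasureTheory.MemLp.comp_sub_right {p : ℝ≥0∞} {f : E3 → ℝ} (hf : MemLp f p volume)
    (h : E3) : MemLp (fun x => f (x - h)) p volume :=
  hf.comp_measurePreserving (measurePreserving_sub_right volume h)

theorem eLpNorm_comp_sub_right {p : ℝ≥0∞} {f : E3 → ℝ} (hf : AEStronglyMeasurable f volume)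
    (h : E3) : eLpNorm (fun x => f (x - h)) p volume = eLpNorm f p volume :=
  eLpNorm_comp_measurePreserving hf (measurePreserving_sub_right volume h)

theorem LpLim.comp_sub_right {ι : Type*} {l : Filter ι} {p : ℝ≥0∞} {F : ι → E3 → ℝ} {f : E3 → ℝ}
    (h : LpLim p l F f) (a : E3) : LpLim p l (fun i x => F i (x - a)) (fun x => f (x - a)) :=
  LpLim.of_le (fun i => (h.memLp i).comp_sub_right a) (h.memLp_lim.comp_sub_right a)
    (fun i => (eLpNorm_comp_sub_right ((h.memLp i).sub h.memLp_lim).1 a).le) h.tendsto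

/-- Translations are strongly continuous on `L^p`, `1 ≤ p < ∞`. -/
theorem LpLim.translate {p : ℝ≥0∞} (hp : 1 ≤ p) (hp' : p ≠ ⊤) {f : E3 → ℝ}
    (hf : MemLp f p volume) : LpLim p (𝓝 (0 : E3)) (fun h x => f (x - h)) f := by
  refine ⟨fun h => hf.comp_sub_right h, hf, ?_⟩
  have : Fact (1 ≤ p) := ⟨hp⟩
  let g : C(E3, C(E3, E3)) := ContinuousMap.curry ⟨fun q : E3 × E3 => q.2 - q.1, by fun_prop⟩
  have hg : ∀ h, MeasurePreserving (g h) volume volume := fun h =>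
    measurePreserving_sub_right volume h
  have hc := Continuous.compMeasurePreservingLp (μ := (volume : Measure E3)) (ν := volume)
    (f := fun _ : E3 => hf.toLp f) (g := g) continuous_const g.continuous hg hp'
  have := (Lp.tendsto_Lp_iff_tendsto_eLpNorm' _ _).1 (hc.tendsto 0)
  refine this.congr fun h => eLpNorm_congr_ae ?_
  have e : ∀ h, ⇑(Lp.compMeasurePreserving (g h) (hg h) (hf.toLp f)) =ᵐ[volume]
      fun x => f (x - h) := fun h =>
    (Lp.coeFn_compMeasurePreserving _ (hg h)).trans
      ((hg h).quasiMeasurePreserving.ae_eq_comp hf.coeFn_toLp)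
  have e0 := e 0
  simp only [sub_zero] at e0
  exact (e h).sub e0

/-- The convolution `f * k` of a function with a kernel. -/
noncomputable def conv (f k : E3 → ℝ) (x : E3) : ℝ := ∫ y, f y * k (x - y)

/-- The rescaled kernel `ε⁻³ k(·/ε)`. -/
noncomputable def rescale (ε : ℝ) (k : E3 → ℝ) (x : E3) : ℝ := ε⁻¹ ^ 3 * k (ε⁻¹ • x)

theorem IsTestFunction.rescale {k : E3 → ℝ} (hk : IsTestFunction k) {ε : ℝ} (hε : 0 < ε) :
    IsTestFunction (rescale ε k) := by
  have h : IsTestFunction (fun x => k (ε⁻¹ • x)) :=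
    ⟨hk.1.comp (by fun_prop), hk.2.comp_smul (inv_ne_zero hε.ne')⟩
  exact h.const_mul _

theorem pd_rescale {k : E3 → ℝ} (hk : IsTestFunction k) {ε : ℝ} (i : Fin 3) :
    pd i (rescale ε k) = fun x => ε⁻¹ * rescale ε (pd i k) x := by
  ext x
  have h1 : HasFDerivAt (fun x : E3 => ε⁻¹ • x) (ε⁻¹ • ContinuousLinearMap.id ℝ E3) x :=
    (hasFDerivAt_id x).const_smul ε⁻¹
  have h2 := ((hk.differentiable (ε⁻¹ • x)).hasFDerivAt.comp x h1).const_mul (ε⁻¹ ^ 3)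
  rw [HasFDerivAt.pd_eq (f := rescale ε k) h2]
  simp [rescale, pd_eq_fderiv]
  ring

theorem IsTestFunction.comp_const_sub {k : E3 → ℝ} (hk : IsTestFunction k) (x : E3) :
    IsTestFunction (fun y => k (x - y)) :=
  ⟨hk.1.comp (by fun_prop), hk.2.comp_homeomorph (Homeomorph.subLeft x)⟩

theorem pd_comp_const_sub {k : E3 → ℝ} (hk : IsTestFunction k) (x y : E3) (i : Fin 3) :
    pd i (fun y => k (x - y)) y = - pd i k (x - y) := by
  have h1 : HasFDerivAt (fun y : E3 => x - y) (-ContinuousLinearMap.id ℝ E3) y :=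
    (hasFDerivAt_id y).const_sub x
  have h2 := (hk.differentiable (x - y)).hasFDerivAt.comp y h1
  rw [HasFDerivAt.pd_eq (f := fun y => k (x - y)) h2]
  simp [pd_eq_fderiv]

section conv

variable {f k : E3 → ℝ}

theorem contDiff_conv (hf : LocallyIntegrable f volume) (hk : IsTestFunction k) :
    ContDiff ℝ ∞ (conv f k) :=
  hk.2.contDiff_convolution_right (n := (⊤ : ℕ∞)) (ContinuousLinearMap.lsmul ℝ ℝ) hf hk.1

theorem pd_conv (hf : LocallyIntegrable f volume) (hk : IsTestFunction k) (i : Fin 3) :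
    pd i (conv f k) = conv f (pd i k) := by
  ext x
  have h := hk.2.hasFDerivAt_convolution_right (ContinuousLinearMap.lsmul ℝ ℝ) hf
    (hk.contDiff' (n := 1)) x
  rw [HasFDerivAt.pd_eq (f := conv f k) h,
    convolution_precompR_apply (hf := hf) (hcg := hk.2.fderiv (𝕜 := ℝ))
      (hg := (hk.1.continuous_fderiv (by simp)))]
  simp [convolution, conv, pd_eq_fderiv]

theorem conv_const_mul (c : ℝ) (f k : E3 → ℝ) :
    conv f (fun x => c * k x) = fun x => c * conv f k x := by
  ext x
  rw [conv, conv, ← integral_const_mul]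
  congr 1
  ext y
  ring

theorem conv_rescale {ε : ℝ} (hε : 0 < ε) (f k : E3 → ℝ) (x : E3) :
    conv f (rescale ε k) x = ∫ z, f (x - ε • z) * k z := by
  have h1 : conv f (rescale ε k) x = ∫ w, f (x - w) * rescale ε k w := by
    rw [conv, ← integral_sub_left_eq_self _ volume x]
    simp
  have h2 := Measure.integral_comp_smul (volume : Measure E3)
    (fun w => f (x - w) * rescale ε k w) ε
  rw [h1]
  simp only [rescale, smul_smul, inv_mul_cancel₀ hε.ne', one_smul, finrank_euclideanSpace,
    Fintype.card_fin, smul_eq_mul] at h2 ⊢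
  have h3 : ∀ z, f (x - ε • z) * (ε⁻¹ ^ 3 * k z) = ε⁻¹ ^ 3 * (f (x - ε • z) * k z) :=
    fun z => by ring
  simp only [h3] at h2
  rw [integral_const_mul, abs_of_pos (by positivity), inv_pow] at h2
  have : (ε ^ 3)⁻¹ ≠ 0 := by positivity
  rw [inv_pow]
  exact (mul_left_cancel₀ this h2).symm

theorem integrable_comp_sub_smul_mul (hf : LocallyIntegrable f volume) (hk : IsTestFunction k)
    {ε : ℝ} (hε : 0 < ε) (x : E3) : Integrable (fun z => f (x - ε • z) * k z) := by
  have h1 := (hk.rescale hε).2.convolutionExists_right (ContinuousLinearMap.lsmul ℝ ℝ) hf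
    (hk.rescale hε).continuous x
  have h2 := ((h1.integrable.comp_sub_left x).comp_smul hε.ne').const_mul (ε ^ 3)
  refine h2.congr (Eventually.of_forall fun z => ?_)
  simp [rescale, smul_smul, hε.ne']
  field_simp [hε.ne']

/-- Convolution of an `L^p` function with a test function is bounded, by Hölder's inequality. -/
theorem abs_conv_le {p q : ℝ≥0∞} [ENNReal.HolderTriple p q 1] (hf : MemLp f p volume)
    (hk : IsTestFunction k) (x : E3) :
    |conv f k x| ≤ (eLpNorm f p volume * eLpNorm k q volume).toReal := by
  have h := enorm_integral_mul_le (p := p) (q := q) hf.1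
    ((hk.comp_const_sub x).continuous.aestronglyMeasurable)
  rw [show eLpNorm (fun y => k (x - y)) q volume = eLpNorm k q volume from
    eLpNorm_comp_measurePreserving hk.continuous.aestronglyMeasurable
      (Measure.measurePreserving_sub_left volume x)] at h
  have := ENNReal.toReal_mono (ENNReal.mul_ne_top hf.2.ne (hk.memLp q).2.ne) h
  simpa [conv] using this

theorem exists_abs_le_and_support (hk : IsTestFunction k) :
    ∃ B R : ℝ, 0 ≤ B ∧ 0 < R ∧ (∀ z, |k z| ≤ B) ∧
      ∀ z, z ∉ Metric.closedBall (0 : E3) R → k z = 0 := by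
  obtain ⟨B, hB⟩ := hk.continuous.bounded_above_of_compact_support hk.2
  obtain ⟨R, hR, hsub⟩ := hk.2.isBounded.subset_closedBall_lt 0 0
  exact ⟨B, R, (norm_nonneg _).trans (hB 0), hR, hB, fun z hz => image_eq_zero_of_notMem_tsupport
    fun h => hz (hsub h)⟩

theorem integral_mul_eq_setIntegral_of_eq_zero {R : ℝ}
    (hR : ∀ z, z ∉ Metric.closedBall (0 : E3) R → k z = 0) (F : E3 → ℝ) :
    ∫ z, F z * k z = ∫ z in Metric.closedBall (0 : E3) R, F z * k z :=
  (setIntegral_eq_integral_of_forall_compl_eq_zero fun z hz => by simp [hR z hz]).symm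

theorem aestronglyMeasurable_comp_sub_smul (hf : AEStronglyMeasurable f volume) (ε : ℝ)
    (ν : Measure E3) [SFinite ν] :
    AEStronglyMeasurable (fun q : E3 × E3 => f (q.1 - ε • q.2)) ((volume : Measure E3).prod ν) :=
  hf.comp_quasiMeasurePreserving
    (quasiMeasurePreserving_sub_comp ν (T := fun z => ε • z) (by fun_prop))

theorem memLp_conv {p : ℝ≥0∞} (hp : 1 ≤ p) (hp' : p ≠ ⊤) (hf : MemLp f p volume)
    (hk : IsTestFunction k) : MemLp (conv f k) p volume := by
  have hfl : LocallyIntegrable f volume := hf.locallyIntegrable hp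
  refine ⟨(contDiff_conv hfl hk).continuous.aestronglyMeasurable, ?_⟩
  obtain ⟨B, R, hB0, -, hB, hR⟩ := exists_abs_le_and_support hk
  have e : conv f k = fun x => ∫ z in Metric.closedBall (0 : E3) R, f (x - (1 : ℝ) • z) * k z := by
    ext x
    rw [← integral_mul_eq_setIntegral_of_eq_zero hR, ← conv_rescale one_pos]
    congr 1
    ext x
    simp [rescale]
  have : IsFiniteMeasure (volume.restrict (Metric.closedBall (0 : E3) R)) :=
    ⟨by rw [Measure.restrict_apply_univ]; exact measure_closedBall_lt_top⟩
  rw [e]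
  refine (eLpNorm_integral_le hp hp' (c := ‖B‖ₑ * eLpNorm f p volume) ?_ ?_).trans_lt ?_
  · exact (aestronglyMeasurable_comp_sub_smul hf.1 1 _).mul
      (hk.continuous.comp continuous_snd).aestronglyMeasurable
  · refine Eventually.of_forall fun z => ?_
    rw [← eLpNorm_comp_sub_right hf.1 ((1 : ℝ) • z), ← eLpNorm_const_smul]
    refine eLpNorm_mono fun x => ?_
    rw [norm_mul, mul_comm, Pi.smul_apply, norm_smul, Real.norm_of_nonneg hB0]
    gcongr
    exact hB z
  · exact ENNReal.mul_lt_top (measure_lt_top _ _) (ENNReal.mul_lt_top (by simp) hf.2)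

/-- Mollification converges in `L^p`, `1 ≤ p < ∞`. -/
theorem LpLim.mollify {p : ℝ≥0∞} (hp : 1 ≤ p) (hp' : p ≠ ⊤) (hf : MemLp f p volume)
    (hk : IsTestFunction k) (hk1 : ∫ z, k z = 1) {ε : ℕ → ℝ} (hε : ∀ n, 0 < ε n)
    (hε0 : Tendsto ε atTop (𝓝 0)) :
    LpLim p atTop (fun n => conv f (rescale (ε n) k)) f := by
  refine ⟨fun n => memLp_conv hp hp' hf (hk.rescale (hε n)), hf, ?_⟩
  have hfl : LocallyIntegrable f volume := hf.locallyIntegrable hp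
  obtain ⟨B, R, hB0, hR0, hB, hR⟩ := exists_abs_le_and_support hk
  have hfin : IsFiniteMeasure (volume.restrict (Metric.closedBall (0 : E3) R)) :=
    ⟨by rw [Measure.restrict_apply_univ]; exact measure_closedBall_lt_top⟩
  have e : ∀ n x, conv f (rescale (ε n) k) x - f x =
      ∫ z in Metric.closedBall (0 : E3) R, (f (x - ε n • z) - f x) * k z := by
    intro n x
    rw [← integral_mul_eq_setIntegral_of_eq_zero hR, conv_rescale (hε n)]
    have h1 : f x = ∫ z, f x * k z := by rw [integral_const_mul, hk1, mul_one]
    conv_lhs => rw [h1]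
    rw [← integral_sub]
    · simp only [sub_mul]
    · exact integrable_comp_sub_smul_mul hfl hk (hε n) x
    · exact hk.integrable.const_mul _
  set V := volume.restrict (Metric.closedBall (0 : E3) R) Set.univ with hV
  have hVt : V ≠ ⊤ := measure_ne_top _ _
  rw [ENNReal.tendsto_nhds_zero]
  intro δ hδ
  have hC : V * ‖B‖ₑ ≠ ⊤ := ENNReal.mul_ne_top hVt (by simp)
  have ht := ENNReal.Tendsto.const_mul (a := V * ‖B‖ₑ) (LpLim.translate hp hp' hf).tendsto
    (Or.inr hC)
  rw [mul_zero, ENNReal.tendsto_nhds_zero] at ht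
  obtain ⟨r, hr, hball⟩ := Metric.eventually_nhds_iff.1 (ht δ hδ)
  have hev : ∀ᶠ n in atTop, ε n * R < r := by
    have := hε0.mul_const R
    rw [zero_mul] at this
    exact this.eventually_lt_const hr
  filter_upwards [hev] with n hn
  simp only [e]
  refine (eLpNorm_integral_le hp hp' (c := δ / V) ?_ ?_).trans ENNReal.mul_div_le
  · exact ((aestronglyMeasurable_comp_sub_smul hf.1 (ε n) _).sub hf.1.comp_fst).mul
      (hk.continuous.comp continuous_snd).aestronglyMeasurable
  · refine (ae_restrict_iff' measurableSet_closedBall).2 (Eventually.of_forall fun z hz => ?_)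
    rw [ENNReal.le_div_iff_mul_le (Or.inr hδ.ne') (Or.inl hVt)]
    refine le_trans ?_ (hball (y := ε n • z) ?_)
    · rw [mul_comm, mul_assoc, ← eLpNorm_const_smul]
      gcongr
      refine eLpNorm_mono fun x => ?_
      rw [norm_mul, mul_comm, Pi.smul_apply, norm_smul, Real.norm_of_nonneg hB0]
      gcongr
      exact hB z
    · rw [dist_zero_right, norm_smul, Real.norm_of_nonneg (hε n).le]
      refine lt_of_le_of_lt ?_ hn
      gcongr
      · exact (hε n).le
      · simpa using hz

end conv

/-! ### Square integrability of the pressure -/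

/-- The Laplacian `∑ᵢ ∂ᵢ∂ᵢ w`. -/
noncomputable def lap (w : E3 → ℝ) (x : E3) : ℝ := ∑ i, pd i (pd i w) x

theorem IsTestFunction.lap {w : E3 → ℝ} (hw : IsTestFunction w) : IsTestFunction (lap w) :=
  IsTestFunction.sum Finset.univ fun i _ => (hw.pd i).pd i

theorem eLpNorm_two_le_of_integral_le {f g : E3 → ℝ} (hf : MemLp f 2 volume)
    (hg : MemLp g 2 volume) (h : ∫ x, f x * f x ≤ ∫ x, g x * g x) :
    eLpNorm f 2 volume ≤ eLpNorm g 2 volume := by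
  rw [hf.eLpNorm_eq_integral_rpow_norm (by simp) (by simp),
    hg.eLpNorm_eq_integral_rpow_norm (by simp) (by simp)]
  have e : ∀ t : ℝ, |t| ^ (2 : ℝ) = t * t := fun t => by
    rw [Real.rpow_two, sq_abs, sq]
  simp only [ENNReal.toReal_ofNat, Real.norm_eq_abs, e]
  refine ENNReal.ofReal_le_ofReal (Real.rpow_le_rpow ?_ h (by norm_num))
  exact integral_nonneg fun x => mul_self_nonneg _

/-- `‖∂ᵢ∂ⱼ w‖₂ ≤ ‖Δw‖₂`, since `∑ᵢⱼ ‖∂ᵢ∂ⱼ w‖₂² = ‖Δw‖₂²`. -/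
theorem eLpNorm_pd_pd_le {w : E3 → ℝ} (hw : IsTestFunction w) (i j : Fin 3) :
    eLpNorm (pd i (pd j w)) 2 volume ≤ eLpNorm (lap w) 2 volume := by
  have hint : ∀ a b c d, Integrable (fun x => pd a (pd b w) x * pd c (pd d w) x) := fun a b c d =>
    (((hw.pd b).pd a).mul ((hw.pd d).pd c)).integrable
  refine eLpNorm_two_le_of_integral_le (((hw.pd j).pd i).memLp 2) (hw.lap.memLp 2) ?_
  have e : ∫ x, lap w x * lap w x = ∑ a, ∑ b, ∫ x, pd a (pd b w) x * pd a (pd b w) x := by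
    simp only [lap, Finset.sum_mul_sum]
    rw [integral_finsetSum _ fun a _ => integrable_finsetSum _ fun b _ => hint _ _ _ _]
    refine Finset.sum_congr rfl fun a _ => ?_
    rw [integral_finsetSum _ fun b _ => hint _ _ _ _]
    refine Finset.sum_congr rfl fun b _ => ?_
    rw [integral_pd_mul_pd_comm (hw.pd a) (hw.pd b)]
    simp only [pd_comm hw.contDiff' b a]
  rw [e]
  have hn : ∀ a b, 0 ≤ ∫ x, pd a (pd b w) x * pd a (pd b w) x := fun a b =>
    integral_nonneg fun x => mul_self_nonneg _
  refine le_trans ?_ (Finset.single_le_sum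
    (f := fun a => ∑ b, ∫ x, pd a (pd b w) x * pd a (pd b w) x)
    (fun a _ => Finset.sum_nonneg fun b _ => hn a b) (Finset.mem_univ i))
  exact Finset.single_le_sum (f := fun b => ∫ x, pd i (pd b w) x * pd i (pd b w) x)
    (fun b _ => hn i b) (Finset.mem_univ j)

/-- A linear functional bounded by `‖A v‖` is represented by an element of the Hilbert space. -/
theorem exists_inner_eq_of_norm_le {V H : Type*} [AddCommGroup V] [Module ℝ V]
    [NormedAddCommGroup H] [InnerProductSpace ℝ H] [CompleteSpace H] (A : V →ₗ[ℝ] H)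
    (L : V →ₗ[ℝ] ℝ) (C : ℝ) (h : ∀ v, |L v| ≤ C * ‖A v‖) :
    ∃ f : H, ∀ v, L v = inner ℝ f (A v) := by
  obtain ⟨s, hs⟩ := A.rangeRestrict.exists_rightInverse_of_surjective A.range_rangeRestrict
  have hs' : ∀ y, A (s y) = y := fun y => congrArg Subtype.val (LinearMap.congr_fun hs y)
  have hg : ∀ y : LinearMap.range A, ‖(L ∘ₗ s) y‖ ≤ C * ‖y‖ := fun y => by
    have := h (s y)
    rwa [hs'] at this
  obtain ⟨g, hgext, -⟩ := exists_extension_norm_eq (LinearMap.range A)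
    ((L ∘ₗ s).mkContinuous C hg)
  refine ⟨(InnerProductSpace.toDual ℝ H).symm g, fun v => ?_⟩
  rw [InnerProductSpace.toDual_symm_apply]
  have h1 := hgext ⟨A v, LinearMap.mem_range_self A v⟩
  have h2 := h (v - s ⟨A v, LinearMap.mem_range_self A v⟩)
  rw [map_sub A, hs', sub_self, norm_zero, mul_zero] at h2
  have h3 := abs_nonpos_iff.1 h2
  rw [map_sub, sub_eq_zero] at h3
  simp only [LinearMap.mkContinuous_apply, LinearMap.comp_apply] at h1
  rw [h1, h3]

/-- The space `C_c^∞(ℝ³)`. -/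
def testSpace : Submodule ℝ (E3 → ℝ) where
  carrier := {φ | IsTestFunction φ}
  add_mem' h1 h2 := h1.add h2
  zero_mem' := ⟨contDiff_const, HasCompactSupport.zero⟩
  smul_mem' c _ h := h.const_mul c

theorem lap_add {v w : E3 → ℝ} (hv : IsTestFunction v) (hw : IsTestFunction w) (x : E3) :
    lap (v + w) x = lap v x + lap w x := by
  have e : ∀ i, pd i (v + w) = fun y => pd i v y + pd i w y := fun i =>
    funext fun y => pd_add hv.differentiable hw.differentiable i y
  simp only [lap, e, ← Finset.sum_add_distrib]
  exact Finset.sum_congr rfl fun i _ =>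
    pd_add (hv.pd i).differentiable (hw.pd i).differentiable i x

theorem lap_smul {w : E3 → ℝ} (hw : IsTestFunction w) (c : ℝ) (x : E3) :
    lap (c • w) x = c * lap w x := by
  have e : ∀ i, pd i (c • w) = fun y => c * pd i w y := fun i =>
    funext fun y => pd_const_mul hw.differentiable c i y
  simp only [lap, e, Finset.mul_sum]
  exact Finset.sum_congr rfl fun i _ => pd_const_mul (hw.pd i).differentiable c i x

/-- If `Δw ↦ ∫ P Δw` is bounded in the `L²` norm, it is represented by some `f ∈ L²`; in other words
`P - f` is harmonic in the sense of distributions. -/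
theorem exists_memLp_two_of_bounded_on_lap {P : E3 → ℝ} (hP : LocallyIntegrable P volume)
    {C : ℝ≥0∞} (hC : C ≠ ⊤)
    (h : ∀ w, IsTestFunction w → ‖∫ x, P x * lap w x‖ₑ ≤ C * eLpNorm (lap w) 2 volume) :
    ∃ f, MemLp f 2 volume ∧ ∀ w, IsTestFunction w → ∫ x, P x * lap w x = ∫ x, f x * lap w x := by
  have hint : ∀ w, IsTestFunction w → Integrable (fun x => P x * lap w x) := fun w hw => by
    simpa [mul_comm] using hP.integrable_smul_left_of_hasCompactSupport hw.lap.continuous hw.lap.2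
  let A : testSpace →ₗ[ℝ] Lp ℝ 2 (volume : Measure E3) :=
    { toFun := fun w => (w.2.lap.memLp 2).toLp (lap w.1)
      map_add' := fun v w => by
        rw [← MemLp.toLp_add]
        exact MemLp.toLp_congr _ _ (Eventually.of_forall fun x => lap_add v.2 w.2 x)
      map_smul' := fun c w => by
        rw [RingHom.id_apply, ← MemLp.toLp_const_smul]
        exact MemLp.toLp_congr _ _ (Eventually.of_forall fun x => lap_smul w.2 c x) }
  let L : testSpace →ₗ[ℝ] ℝ :=
    { toFun := fun w => ∫ x, P x * lap w.1 x
      map_add' := fun v w => by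
        rw [← integral_add (hint _ v.2) (hint _ w.2)]
        congr 1
        ext x
        rw [← mul_add, ← lap_add v.2 w.2]
        rfl
      map_smul' := fun c w => by
        rw [RingHom.id_apply, smul_eq_mul, ← integral_const_mul]
        congr 1
        ext x
        rw [mul_left_comm, ← lap_smul w.2]
        rfl }
  obtain ⟨f, hf⟩ := exists_inner_eq_of_norm_le A L C.toReal fun w => by
    have := ENNReal.toReal_mono (ENNReal.mul_ne_top hC (w.2.lap.memLp 2).2.ne) (h w.1 w.2)
    rw [ENNReal.toReal_mul, toReal_enorm] at this
    exact this.trans_eq (by rw [← Lp.norm_toLp _ (w.2.lap.memLp 2)]; rfl)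
  refine ⟨f, Lp.memLp f, fun w hw => ?_⟩
  have := hf ⟨w, hw⟩
  rw [L2.inner_def] at this
  refine Eq.trans this (integral_congr_ae ?_)
  filter_upwards [(hw.lap.memLp 2).coeFn_toLp] with x hx
  have : A ⟨w, hw⟩ = (hw.lap.memLp 2).toLp (lap w) := rfl
  rw [this, hx]
  simp [mul_comm]

theorem exists_cutoff : ∃ χ : E3 → ℝ, IsTestFunction χ ∧ (∀ x, 0 ≤ χ x) ∧
    ∀ x, ‖x‖ ≤ 1 → χ x = 1 := by
  let b : ContDiffBump (0 : E3) := ⟨1, 2, by norm_num, by norm_num⟩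
  exact ⟨b, ⟨b.contDiff, b.hasCompactSupport⟩, fun x => b.nonneg,
    fun x hx => b.one_of_mem_closedBall (by simpa using hx)⟩

theorem exists_mollifier : ∃ k : E3 → ℝ, IsTestFunction k ∧ (∀ x, 0 ≤ k x) ∧ ∫ x, k x = 1 := by
  let b : ContDiffBump (0 : E3) := ⟨1, 2, by norm_num, by norm_num⟩
  exact ⟨b.normed volume, ⟨b.contDiff_normed, b.hasCompactSupport_normed⟩,
    fun x => b.nonneg_normed x, b.integral_normed⟩

/-- A harmonic function in `L²(ℝ³)` vanishes: `2 ∫ ψ |∇h|² = ∫ h² Δψ` for cut-off functions `ψ`,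
and the right-hand side is `O(R⁻²)` for a cut-off at scale `R`. -/
theorem eq_zero_of_lap_eq_zero {h : E3 → ℝ} (hs : ContDiff ℝ ∞ h) (h2 : MemLp h 2 volume)
    (h0 : ∀ x, lap h x = 0) : ∀ x, h x = 0 := by
  have hd : Differentiable ℝ h := hs.differentiable (by simp)
  have hpd : ∀ i, ContDiff ℝ ∞ (pd i h) := fun i => hs.pd (by simp) i
  have hpdd : ∀ i, Differentiable ℝ (pd i h) := fun i => (hpd i).differentiable (by simp)
  have hsq : ContDiff ℝ ∞ (fun x => h x * h x) := hs.mul hs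
  have hpsq : ∀ i, pd i (fun x => h x * h x) = fun x => h x * pd i h x + pd i h x * h x :=
    fun i => funext fun x => pd_mul hd hd i x
  set D : E3 → ℝ := fun x => ∑ i, pd i h x * pd i h x with hD
  have hD0 : ∀ x, 0 ≤ D x := fun x => Finset.sum_nonneg fun i _ => mul_self_nonneg _
  have hDc : Continuous D :=
    continuous_finsetSum _ fun i _ => (hpd i).continuous.mul (hpd i).continuous
  have hlapsq : ∀ x, ∑ i, pd i (pd i (fun x => h x * h x)) x = 2 * D x := by
    intro x
    have : ∀ i, pd i (pd i (fun x => h x * h x)) x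
        = 2 * (pd i h x * pd i h x) + 2 * h x * pd i (pd i h) x := fun i => by
      rw [hpsq, pd_add (hd.fun_mul (hpdd i)) ((hpdd i).fun_mul hd), pd_mul hd (hpdd i),
        pd_mul (hpdd i) hd]
      ring
    simp only [this, Finset.sum_add_distrib, ← Finset.mul_sum]
    have := h0 x
    rw [lap] at this
    rw [this, mul_zero, add_zero]
  have hgreen : ∀ ψ, IsTestFunction ψ → ∫ x, (h x * h x) * lap ψ x = 2 * ∫ x, D x * ψ x := by
    intro ψ hψ
    have hi : ∀ i, ∫ x, (h x * h x) * pd i (pd i ψ) x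
        = ∫ x, pd i (pd i (fun x => h x * h x)) x * ψ x := fun i => by
      have h1' : ContDiff ℝ 1 (fun x => h x * h x) := hsq.of_le (by exact_mod_cast le_top)
      have h2' : ContDiff ℝ 1 (pd i fun x => h x * h x) :=
        (hsq.pd (m := ∞) (by simp) i).of_le (by exact_mod_cast le_top)
      rw [integral_mul_pd h1' (hψ.pd i).contDiff' (hψ.pd i).2,
        integral_mul_pd h2' hψ.contDiff' hψ.2,
        neg_neg]
    simp only [lap, Finset.mul_sum]
    rw [integral_finsetSum _ fun i _ => ?_, ← integral_const_mul]
    · simp only [hi]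
      rw [← integral_finsetSum _ fun i _ => ?_]
      · congr 1
        ext x
        rw [← Finset.sum_mul, hlapsq, mul_assoc]
      · exact (((hsq.pd (m := ∞) (by simp) i).pd (m := ∞) (by simp) i).continuous.mul
          hψ.continuous).integrable_of_hasCompactSupport hψ.2.mul_left
    · exact (hsq.continuous.mul ((hψ.pd i).pd i).continuous).integrable_of_hasCompactSupport
        ((hψ.pd i).pd i).2.mul_left
  obtain ⟨χ, hχ, hχ0, hχ1⟩ := exists_cutoff
  obtain ⟨B, hB⟩ := hχ.lap.continuous.bounded_above_of_compact_support hχ.lap.2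
  have hsqint : Integrable (fun x => h x * h x) := h2.integrable_mul h2
  set N := ∫ x, h x * h x with hN
  have hball : ∀ r : ℝ, ∫ x in Metric.closedBall (0 : E3) r, D x = 0 := by
    intro r
    have hle : ∀ R : ℝ, 0 < R → r ≤ R →
        ∫ x in Metric.closedBall (0 : E3) r, D x ≤ R⁻¹ ^ 2 * (B * N) := by
      intro R hR hrR
      have hψ := hχ.rescale hR
      have hlapψ : ∀ x, lap (rescale R χ) x = R⁻¹ ^ 2 * (R⁻¹ ^ 3 * lap χ (R⁻¹ • x)) := by
        intro x
        have e : ∀ i, pd i (pd i (rescale R χ)) x = R⁻¹ ^ 2 * rescale R (pd i (pd i χ)) x := by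
          intro i
          rw [pd_rescale hχ, pd_const_mul ((hχ.pd i).rescale hR).differentiable,
            pd_rescale (hχ.pd i)]
          ring
        simp only [lap, e, rescale, Finset.mul_sum]
      have hg := hgreen _ hψ
      have e1 : ∫ x, D x * rescale R χ x = R⁻¹ ^ 3 * ∫ x, D x * χ (R⁻¹ • x) := by
        rw [← integral_const_mul]
        congr 1
        ext x
        rw [rescale]
        ring
      have e2 : ∫ x, (h x * h x) * lap (rescale R χ) x
          = R⁻¹ ^ 3 * (R⁻¹ ^ 2 * ∫ x, (h x * h x) * lap χ (R⁻¹ • x)) := by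
        rw [← integral_const_mul, ← integral_const_mul]
        congr 1
        ext x
        rw [hlapψ]
        ring
      rw [e1, e2, mul_left_comm 2] at hg
      have hg' := mul_left_cancel₀ (by positivity : R⁻¹ ^ 3 ≠ 0) hg
      have hup : ∫ x, (h x * h x) * lap χ (R⁻¹ • x) ≤ B * N := by
        rw [hN, ← integral_const_mul]
        refine (Real.le_norm_self _).trans (norm_integral_le_of_norm_le (hsqint.const_mul B)
          (Eventually.of_forall fun x => ?_))
        rw [norm_mul, Real.norm_of_nonneg (mul_self_nonneg _), mul_comm]
        exact mul_le_mul_of_nonneg_right (hB _) (mul_self_nonneg _)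
      have hDint : Integrable (fun x => D x * χ (R⁻¹ • x)) := by
        refine (hDc.mul (hχ.continuous.comp (by fun_prop))).integrable_of_hasCompactSupport ?_
        exact (hχ.2.comp_smul (inv_ne_zero hR.ne')).mul_left
      have hlow : ∫ x in Metric.closedBall (0 : E3) r, D x ≤ ∫ x, D x * χ (R⁻¹ • x) := by
        refine le_trans (le_of_eq ?_) (setIntegral_le_integral (s := Metric.closedBall (0 : E3) r)
          hDint (Eventually.of_forall fun x => mul_nonneg (hD0 x) (hχ0 _)))
        refine setIntegral_congr_fun measurableSet_closedBall fun x hx => ?_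
        have hx' : ‖x‖ ≤ r := by simpa using hx
        change D x = D x * χ (R⁻¹ • x)
        rw [hχ1, mul_one]
        rw [norm_smul, norm_inv, Real.norm_of_nonneg hR.le, inv_mul_le_one₀ hR]
        linarith
      have hnn : 0 ≤ ∫ x, D x * χ (R⁻¹ • x) :=
        integral_nonneg fun x => mul_nonneg (hD0 x) (hχ0 _)
      have := mul_le_mul_of_nonneg_left hup (by positivity : 0 ≤ R⁻¹ ^ 2)
      linarith
    refine le_antisymm ?_ (integral_nonneg hD0)
    have ht : Tendsto (fun R : ℝ => R⁻¹ ^ 2 * (B * N)) atTop (𝓝 0) := by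
      simpa using (tendsto_inv_atTop_zero.pow 2).mul_const (B * N)
    refine ge_of_tendsto ht ?_
    filter_upwards [eventually_gt_atTop 0, eventually_ge_atTop r] with R h1 h2 using hle R h1 h2
  have hDz : ∀ x, D x = 0 := by
    have hae : D =ᵐ[volume] fun _ => 0 := by
      have := ae_all_iff.2 fun r : ℕ => (ae_restrict_iff' (μ := volume)
        (measurableSet_closedBall (x := (0 : E3)) (ε := r))).1
          ((setIntegral_eq_zero_iff_of_nonneg_ae (Eventually.of_forall hD0)
            (hDc.continuousOn.integrableOn_compact (isCompact_closedBall _ _))).1 (hball r))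
      filter_upwards [this] with x hx
      obtain ⟨r, hr⟩ := exists_nat_ge ‖x‖
      exact hx r (by simpa using hr)
    exact fun x => congrFun ((hDc.ae_eq_iff_eq volume continuous_const).1 hae) x
  have hpz : ∀ i x, pd i h x = 0 := fun i x => by
    have := (Finset.sum_eq_zero_iff_of_nonneg fun j _ => mul_self_nonneg (pd j h x)).1 (hDz x) i
      (Finset.mem_univ i)
    exact mul_self_eq_zero.1 this
  have hconst : ∀ x, h x = h 0 := fun x =>
    is_const_of_fderiv_eq_zero hd (fun y => by
      ext v
      rw [fderiv_apply_eq_sum_pd]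
      simp [hpz]) x 0
  have : MemLp (fun _ : E3 => h 0) 2 volume := by
    have e : h = fun _ => h 0 := funext hconst
    rwa [e] at h2
  rw [memLp_const_iff (by norm_num) (by norm_num)] at this
  intro x
  rw [hconst x]
  simpa using this

/-- A function `P ∈ L¹` whose distributional gradient lies in `div L² + L^{6/5}`, the dual of
`D₀^{1,2}`, belongs to `L²`. -/
theorem memLp_two_of_weak_gradient {P : E3 → ℝ} (hP : MemLp P 1 volume)
    {H : Fin 3 → Fin 3 → E3 → ℝ} (hH : ∀ i j, MemLp (H i j) 2 volume)
    {F : Fin 3 → E3 → ℝ} (hF : ∀ i, MemLp (F i) (6 / 5) volume)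
    (h : ∀ φ : Fin 3 → E3 → ℝ, (∀ i, IsTestFunction (φ i)) →
      ∫ x, P x * ∑ i, pd i (φ i) x =
        (∑ i, ∑ j, ∫ x, H i j x * pd j (φ i) x) - ∑ i, ∫ x, F i x * φ i x) :
    MemLp P 2 volume := by
  have hPl : LocallyIntegrable P volume := hP.locallyIntegrable le_rfl
  obtain ⟨S, hS, hSob⟩ := exists_eLpNorm_six_le
  have i65 : ENNReal.HolderTriple (6 / 5) 6 1 := holderTriple_of_toReal (by simp) (by simp)
    (by simp) (by simp; norm_num)
  set C : ℝ≥0∞ := (∑ i, ∑ j, eLpNorm (H i j) 2 volume) + ∑ i, eLpNorm (F i) (6 / 5) volume * (S * 3)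
    with hC
  have hCt : C ≠ ⊤ := by
    simp only [hC, ne_eq, ENNReal.add_eq_top, not_or, ENNReal.sum_eq_top, not_exists, not_and]
    refine ⟨fun i _ j _ => (hH i j).2.ne, fun i _ => ?_⟩
    exact ENNReal.mul_ne_top (hF i).2.ne (ENNReal.mul_ne_top hS (by simp))
  -- `∇w` is an admissible test field, and `‖∂ᵢw‖₆` is controlled by the second derivatives of `w`.
  obtain ⟨f, hf, hPf⟩ := exists_memLp_two_of_bounded_on_lap hPl hCt fun w hw => by
    have := h (fun i => pd i w) fun i => hw.pd i
    change ‖∫ x, P x * ∑ i, pd i (pd i w) x‖ₑ ≤ _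
    rw [this, hC, add_mul, Finset.sum_mul, Finset.sum_mul]
    refine enorm_sub_le.trans (add_le_add ?_ ?_)
    · refine (enorm_sum_le _ _).trans (Finset.sum_le_sum fun i _ => ?_)
      rw [Finset.sum_mul]
      refine (enorm_sum_le _ _).trans (Finset.sum_le_sum fun j _ => ?_)
      refine (enorm_integral_mul_le (p := 2) (q := 2) (hH i j).1
        ((hw.pd i).pd j).continuous.aestronglyMeasurable).trans ?_
      gcongr
      exact eLpNorm_pd_pd_le hw j i
    · refine (enorm_sum_le _ _).trans (Finset.sum_le_sum fun i _ => ?_)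
      refine (enorm_integral_mul_le (p := 6 / 5) (q := 6) (hF i).1
        (hw.pd i).continuous.aestronglyMeasurable).trans ?_
      rw [mul_assoc]
      gcongr
      refine (hSob _ (hw.pd i)).trans ?_
      rw [mul_assoc]
      gcongr
      refine (Finset.sum_le_sum fun j _ => eLpNorm_pd_pd_le hw j i).trans ?_
      simp
  obtain ⟨k, hk, -, hk1⟩ := exists_mollifier
  have hfl : LocallyIntegrable f volume := hf.locallyIntegrable (by norm_num)
  have hε : ∀ n : ℕ, (0 : ℝ) < 1 / ((n : ℝ) + 1) := fun n => by positivity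
  have hε0 := tendsto_one_div_add_atTop_nhds_zero_nat (𝕜 := ℝ)
  have hlim1 := LpLim.mollify (p := 1) le_rfl (by simp) hP hk hk1 hε hε0
  have hlim2 := LpLim.mollify (p := 2) (by norm_num) (by simp) hf hk hk1 hε hε0
  -- The mollifications of `P` and `f` differ by a harmonic function in `L²`.
  have heq : ∀ n : ℕ, conv P (rescale (1 / ((n : ℝ) + 1)) k) =
      conv f (rescale (1 / ((n : ℝ) + 1)) k) := by
    intro n
    have hkn := hk.rescale (hε n)
    set κ := rescale (1 / ((n : ℝ) + 1)) k with hκ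
    have hb : MemLp (conv P κ) 2 volume :=
      memLp_of_bounded_of_le (by simp) (by simp) (by norm_num) (by simp)
        (memLp_conv le_rfl (by simp) hP hkn) (abs_conv_le (p := 1) (q := ⊤) hP hkn)
    have c1 := contDiff_conv hPl hkn
    have c2 := contDiff_conv hfl hkn
    have hz := eq_zero_of_lap_eq_zero (h := fun x => conv P κ x - conv f κ x) (c1.sub c2)
      (hb.sub (memLp_conv (by norm_num) (by simp) hf hkn)) fun x => ?_
    · ext x
      exact sub_eq_zero.1 (hz x)
    have e : ∀ i, pd i (pd i fun x => conv P κ x - conv f κ x) x =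
        conv P (pd i (pd i κ)) x - conv f (pd i (pd i κ)) x := fun i => by
      have e1 : pd i (fun x => conv P κ x - conv f κ x) =
          fun x => conv P (pd i κ) x - conv f (pd i κ) x := by
        ext y
        rw [pd_sub (c1.differentiable (by simp)) (c2.differentiable (by simp)), pd_conv hPl hkn,
          pd_conv hfl hkn]
      rw [e1, pd_sub ((contDiff_conv hPl (hkn.pd i)).differentiable (by simp))
        ((contDiff_conv hfl (hkn.pd i)).differentiable (by simp)), pd_conv hPl (hkn.pd i),
          pd_conv hfl (hkn.pd i)]
    have hw := hkn.comp_const_sub x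
    have hlapw : ∀ y, lap (fun y => κ (x - y)) y = ∑ i, pd i (pd i κ) (x - y) := by
      intro y
      refine Finset.sum_congr rfl fun i _ => ?_
      have : pd i (fun y => κ (x - y)) = fun y => (-1) * pd i κ (x - y) := by
        ext y
        rw [pd_comp_const_sub hkn]
        ring
      rw [this, pd_const_mul ((hkn.pd i).comp_const_sub x).differentiable,
        pd_comp_const_sub (hkn.pd i)]
      ring
    have hsum : ∀ g : E3 → ℝ, LocallyIntegrable g volume →
        ∑ i, conv g (pd i (pd i κ)) x = ∫ y, g y * lap (fun y => κ (x - y)) y := by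
      intro g hg
      simp only [hlapw, Finset.mul_sum, conv]
      rw [integral_finsetSum _ fun i _ => ?_]
      have ht := ((hkn.pd i).pd i).comp_const_sub x
      simpa [mul_comm] using hg.integrable_smul_left_of_hasCompactSupport ht.continuous ht.2
    simp only [lap, e, Finset.sum_sub_distrib]
    rw [hsum P hPl, hsum f hfl, hPf _ hw, sub_self]
  have : P =ᵐ[volume] f := by
    refine LpLim.ae_unique (p := 1) (q := 2) (by simp) (by simp) hlim1 ?_
    simpa only [heq] using hlim2
  exact hf.ae_eq this.symm

/-! ### Difference quotients of `D₀^{1,2}` functions -/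

/-- The average `∫₀¹ V(x - t h) dt` of `V` over the segment from `x - h` to `x`. -/
noncomputable def segAvg (h : E3) (V : E3 → ℝ) (x : E3) : ℝ :=
  ∫ t in Set.Ioc (0 : ℝ) 1, V (x - t • h)

section segAvg

variable {p : ℝ≥0∞} {V : E3 → ℝ}

theorem aestronglyMeasurable_segment (hV : AEStronglyMeasurable V volume) (h : E3) :
    AEStronglyMeasurable (Function.uncurry fun (x : E3) (t : ℝ) => V (x - t • h))
      ((volume : Measure E3).prod (volume.restrict (Set.Ioc (0 : ℝ) 1))) :=
  hV.comp_quasiMeasurePreserving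
    (quasiMeasurePreserving_sub_comp _ (T := fun t : ℝ => t • h) (by fun_prop))

theorem eLpNorm_segAvg_le (hp : 1 ≤ p) (hp' : p ≠ ⊤) (hV : AEStronglyMeasurable V volume)
    (h : E3) : eLpNorm (segAvg h V) p volume ≤ eLpNorm V p volume := by
  refine (eLpNorm_integral_le hp hp' (c := eLpNorm V p volume)
    (aestronglyMeasurable_segment hV h)
    (Eventually.of_forall fun t => (eLpNorm_comp_sub_right hV _).le)).trans_eq (by simp)

theorem memLp_segAvg (hp : 1 ≤ p) (hp' : p ≠ ⊤) (hV : MemLp V p volume) (h : E3) :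
    MemLp (segAvg h V) p volume :=
  ⟨(aestronglyMeasurable_segment hV.1 h).integral_prod_right',
    (eLpNorm_segAvg_le hp hp' hV.1 h).trans_lt hV.2⟩

theorem ae_integrable_segment (hp : 1 ≤ p) (hp' : p ≠ ⊤) (hV : MemLp V p volume) (h : E3) :
    ∀ᵐ x : E3, Integrable (fun t : ℝ => V (x - t • h)) (volume.restrict (Set.Ioc (0 : ℝ) 1)) :=
  ae_integrable_of_eLpNorm_le hp hp' (c := eLpNorm V p volume)
    (aestronglyMeasurable_segment hV.1 h) hV.2.ne
    (Eventually.of_forall fun _ => (eLpNorm_comp_sub_right hV.1 _).le)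

theorem LpLim.segAvg {ι : Type*} {l : Filter ι} (hp : 1 ≤ p) (hp' : p ≠ ⊤) {F : ι → E3 → ℝ}
    (hF : LpLim p l F V) (h : E3) : LpLim p l (fun i => segAvg h (F i)) (segAvg h V) := by
  refine LpLim.of_le (fun i => memLp_segAvg hp hp' (hF.memLp i) h)
    (memLp_segAvg hp hp' hF.memLp_lim h) (fun i => ?_) hF.tendsto
  refine le_trans (le_of_eq (eLpNorm_congr_ae ?_)) (eLpNorm_segAvg_le hp hp'
    ((hF.memLp i).sub hF.memLp_lim).1 h)
  filter_upwards [ae_integrable_segment hp hp' (hF.memLp i) h,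
    ae_integrable_segment hp hp' hF.memLp_lim h] with x h1 h2
  exact (integral_sub h1 h2).symm

/-- Averages over short segments converge in `L^p`. -/
theorem lpLim_segAvg_zero (hp : 1 ≤ p) (hp' : p ≠ ⊤) (hV : MemLp V p volume)
    {h : ℕ → E3} (hh : Tendsto h atTop (𝓝 0)) :
    LpLim p atTop (fun n => segAvg (h n) V) V := by
  refine ⟨fun n => memLp_segAvg hp hp' hV (h n), hV, ?_⟩
  rw [ENNReal.tendsto_nhds_zero]
  intro δ hδ
  obtain ⟨r, hr, hball⟩ := Metric.eventually_nhds_iff.1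
    (ENNReal.tendsto_nhds_zero.1 (LpLim.translate hp hp' hV).tendsto δ hδ)
  filter_upwards [Metric.tendsto_nhds.1 hh r hr] with n hn
  have e : (fun x => segAvg (h n) V x - V x) =ᵐ[volume]
      fun x => ∫ t in Set.Ioc (0 : ℝ) 1, (V (x - t • h n) - V x) := by
    filter_upwards [ae_integrable_segment hp hp' hV (h n)] with x hx
    rw [integral_sub hx (integrable_const _)]
    simp [segAvg]
  rw [eLpNorm_congr_ae e]
  refine (eLpNorm_integral_le hp hp' (c := δ)
    ((aestronglyMeasurable_segment hV.1 (h n)).sub hV.1.comp_fst) ?_).trans_eq (by simp)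
  refine (ae_restrict_iff' measurableSet_Ioc).2 (Eventually.of_forall fun t ht => ?_)
  refine hball (y := t • h n) (lt_of_le_of_lt ?_ hn)
  rw [dist_zero_right, dist_zero_right, norm_smul, Real.norm_of_nonneg ht.1.le]
  exact mul_le_of_le_one_left (norm_nonneg _) ht.2

end segAvg

theorem sub_comp_sub_eq_segAvg {φ : E3 → ℝ} (hφ : IsTestFunction φ) (h x : E3) :
    φ x - φ (x - h) = segAvg h (fun y => ∑ k, h k * pd k φ y) x := by
  have hd : ∀ t : ℝ, HasDerivAt (fun t : ℝ => - φ (x - t • h))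
      (∑ k, h k * pd k φ (x - t • h)) t := by
    intro t
    have h1 : HasDerivAt (fun t : ℝ => x - t • h) (-h) t := by
      simpa using ((hasDerivAt_id t).smul_const h).const_sub x
    have h2 := ((hφ.differentiable (x - t • h)).hasFDerivAt.comp_hasDerivAt t h1).neg
    rw [map_neg, neg_neg, fderiv_apply_eq_sum_pd] at h2
    exact h2
  have hc : Continuous fun t : ℝ => ∑ k, h k * pd k φ (x - t • h) :=
    continuous_finsetSum _ fun k _ => continuous_const.mul
      ((hφ.pd k).continuous.comp (by fun_prop))
  have := intervalIntegral.integral_eq_sub_of_hasDerivAt (a := 0) (b := 1) (fun t _ => hd t)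
    (hc.intervalIntegrable _ _)
  rw [intervalIntegral.integral_of_le zero_le_one] at this
  rw [segAvg, this]
  simp
  ring

theorem D12Approx.lpLim_dir {φ : ℕ → E3 → ℝ} {f : E3 → ℝ} {g : Fin 3 → E3 → ℝ}
    (h : D12Approx φ f g) (z : E3) : LpLim 2 atTop (fun n x => ∑ k, z k * pd k (φ n) x)
      (fun x => ∑ k, z k * g k x) :=
  LpLim.sum Finset.univ (by norm_num) fun k _ => (h.lim_pd k).const_mul (z k)

/-- Differences of a `D₀^{1,2}` function are averages of its weak gradient along a segment. -/
theorem D12Approx.sub_comp_sub_ae_eq {φ : ℕ → E3 → ℝ} {f : E3 → ℝ} {g : Fin 3 → E3 → ℝ}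
    (h : D12Approx φ f g) (z : E3) :
    (fun x => f x - f (x - z)) =ᵐ[volume] segAvg z (fun x => ∑ k, z k * g k x) := by
  have h1 : LpLim 6 atTop (fun n x => φ n x - φ n (x - z)) (fun x => f x - f (x - z)) :=
    h.lim.sub (by norm_num) (h.lim.comp_sub_right z)
  have h2 := (h.lpLim_dir z).segAvg (by norm_num) (by simp) z
  have e : ∀ n, segAvg z (fun x => ∑ k, z k * pd k (φ n) x) = fun x => φ n x - φ n (x - z) :=
    fun n => funext fun x => (sub_comp_sub_eq_segAvg (h.test n) z x).symm
  simp only [e] at h2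
  exact h1.ae_unique (by norm_num) (by norm_num) h2

theorem D12Approx.diffQuot_ae_eq {φ : ℕ → E3 → ℝ} {f : E3 → ℝ} {g : Fin 3 → E3 → ℝ}
    (h : D12Approx φ f g) (z : E3) {ε : ℝ} (hε : 0 < ε) :
    (fun x => ε⁻¹ * (f x - f (x - ε • z))) =ᵐ[volume]
      segAvg (ε • z) (fun x => ∑ k, z k * g k x) := by
  filter_upwards [h.sub_comp_sub_ae_eq (ε • z)] with x hx
  rw [hx, segAvg, segAvg, ← integral_const_mul]
  congr 1
  ext t
  simp only [PiLp.smul_apply, smul_eq_mul, mul_assoc, ← Finset.mul_sum]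
  rw [inv_mul_cancel_left₀ hε.ne']

/-- Difference quotients are bounded by the gradient, uniformly in the step. -/
theorem D12Approx.eLpNorm_diffQuot_le {φ : ℕ → E3 → ℝ} {f : E3 → ℝ} {g : Fin 3 → E3 → ℝ}
    (h : D12Approx φ f g) (z : E3) {ε : ℝ} (hε : 0 < ε) :
    eLpNorm (fun x => ε⁻¹ * (f x - f (x - ε • z))) 2 volume ≤
      ‖z‖ₑ * ∑ k, eLpNorm (g k) 2 volume := by
  rw [eLpNorm_congr_ae (h.diffQuot_ae_eq z hε)]
  refine (eLpNorm_segAvg_le (by norm_num) (by simp) (h.lpLim_dir z).memLp_lim.1 _).trans ?_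
  have e : (fun x => ∑ k, z k * g k x) = ∑ k, fun x => z k * g k x := by
    ext x
    simp
  rw [e, Finset.mul_sum]
  refine (eLpNorm_sum_le (fun k _ => ((h.lim_pd k).memLp_lim.const_mul (z k)).1)
    (by norm_num)).trans (Finset.sum_le_sum fun k _ => ?_)
  refine (eLpNorm_const_smul (z k) (g k) 2 volume).le.trans ?_
  gcongr
  exact enorm_le_iff_norm_le.2 (PiLp.norm_apply_le z k)

theorem D12Approx.lpLim_diffQuot {φ : ℕ → E3 → ℝ} {f : E3 → ℝ} {g : Fin 3 → E3 → ℝ}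
    (h : D12Approx φ f g) (z : E3) {ε : ℕ → ℝ} (hε : ∀ n, 0 < ε n)
    (hε0 : Tendsto ε atTop (𝓝 0)) :
    LpLim 2 atTop (fun n x => (ε n)⁻¹ * (f x - f (x - ε n • z))) (fun x => ∑ k, z k * g k x) := by
  have hV := (h.lpLim_dir z).memLp_lim
  have h0 : Tendsto (fun n => ε n • z) atTop (𝓝 0) := by simpa using hε0.smul_const z
  have hl := lpLim_segAvg_zero (by norm_num) (by simp) hV h0
  refine ⟨fun n => (hl.memLp n).ae_eq (h.diffQuot_ae_eq z (hε n)).symm, hV,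
    hl.tendsto.congr fun n => eLpNorm_congr_ae ?_⟩
  filter_upwards [h.diffQuot_ae_eq z (hε n)] with x hx
  rw [hx]

/-- Integration by parts for a `D₀^{1,2}` function against a `C¹` function `Φ` without compact
support, under the integrability that makes both sides limits of those for test functions. -/
theorem D12Approx.integral_mul_pd {φ : ℕ → E3 → ℝ} {f : E3 → ℝ} {g : Fin 3 → E3 → ℝ}
    (h : D12Approx φ f g) {Φ : E3 → ℝ} (hΦ : ContDiff ℝ 1 Φ) (hΦ2 : MemLp Φ 2 volume) (j : Fin 3)
    (hpd : MemLp (pd j Φ) (6 / 5) volume) :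
    ∫ x, f x * pd j Φ x = - ∫ x, Φ x * g j x := by
  have i65 : ENNReal.HolderTriple 6 (6 / 5) 1 := holderTriple_of_toReal (by simp) (by simp)
    (by simp) (by simp; norm_num)
  have t1 := (h.lim.mul le_rfl (LpLim.const hpd)).tendsto_integral
  have t2 := ((LpLim.const (l := atTop) hΦ2).mul (r := 1) le_rfl (h.lim_pd j)).tendsto_integral.neg
  refine tendsto_nhds_unique (t1.congr fun n => ?_) t2
  rw [_root_.integral_mul_pd hΦ (h.test n).contDiff' (h.test n).2, neg_neg]
  congr 1
  ext x
  ring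

theorem integral_coord_mul_pd {k : E3 → ℝ} (hk : IsTestFunction k) (hk1 : ∫ z, k z = 1)
    (i j : Fin 3) : ∫ z : E3, z i * pd j k z = if i = j then -1 else 0 := by
  have hc : ContDiff ℝ 1 (fun z : E3 => z i) := (EuclideanSpace.proj (𝕜 := ℝ) i).contDiff
  have hp : ∀ z : E3, pd j (fun z : E3 => z i) z = if i = j then 1 else 0 := fun z => by
    rw [HasFDerivAt.pd_eq (f := fun z : E3 => z i) (EuclideanSpace.proj (𝕜 := ℝ) i).hasFDerivAt]
    simp
  rw [integral_mul_pd hc hk.contDiff' hk.2]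
  simp only [hp, integral_const_mul, hk1]
  split_ifs <;> simp

/-! ### Renormalised continuity equation -/

section transport

variable {ρ : E3 → ℝ} {u : Fin 3 → E3 → ℝ} {g : Fin 3 → Fin 3 → E3 → ℝ}
  {φ : Fin 3 → ℕ → E3 → ℝ} {k : E3 → ℝ}

/-- For a mollified density the convective derivative `u · ∇(ρ * k_ε)` is the Friedrichs commutator,
an integral over difference quotients of `u`. -/
theorem sum_mul_pd_mollify (hρ : LocallyIntegrable ρ volume)
    (hρu : ∀ j, LocallyIntegrable (fun x => ρ x * u j x) volume)
    (hmass : ∀ ψ, IsTestFunction ψ → ∫ x, ∑ j, ρ x * u j x * pd j ψ x = 0)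
    (hk : IsTestFunction k) {ε : ℝ} (hε : 0 < ε) (x : E3) :
    ∑ j, u j x * pd j (conv ρ (rescale ε k)) x =
      ∑ j, ∫ z, ε⁻¹ * (u j x - u j (x - ε • z)) * ρ (x - ε • z) * pd j k z := by
  have hκ := hk.rescale hε
  have h0 : ∑ j, ∫ z, ρ (x - ε • z) * u j (x - ε • z) * pd j k z = 0 := by
    have := hmass _ (hκ.comp_const_sub x)
    rw [integral_finsetSum _ fun j _ => ?_] at this
    · have e : ∀ j, ∫ y, ρ y * u j y * pd j (fun y => rescale ε k (x - y)) y =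
          - ε⁻¹ * ∫ z, ρ (x - ε • z) * u j (x - ε • z) * pd j k z := fun j => by
        simp only [pd_comp_const_sub hκ, pd_rescale hk]
        have h1 := conv_rescale hε (fun x => ρ x * u j x) (pd j k) x
        rw [← h1, conv, ← integral_const_mul]
        congr 1
        ext y
        ring
      simp only [e, ← Finset.mul_sum] at this
      exact (mul_eq_zero.1 this).resolve_left (by simp [hε.ne'])
    · have ht := (hκ.comp_const_sub x).pd j
      simpa [mul_comm] using (hρu j).integrable_smul_left_of_hasCompactSupport ht.continuous ht.2
  have e : ∀ j, ∫ z, ε⁻¹ * (u j x - u j (x - ε • z)) * ρ (x - ε • z) * pd j k z =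
      u j x * pd j (conv ρ (rescale ε k)) x -
        ε⁻¹ * ∫ z, ρ (x - ε • z) * u j (x - ε • z) * pd j k z := fun j => by
    rw [pd_conv hρ hκ, pd_rescale hk, conv_const_mul]
    beta_reduce
    rw [conv_rescale hε, ← integral_const_mul,
      ← integral_const_mul, ← integral_const_mul, ← integral_sub]
    · congr 1
      ext z
      ring
    · exact ((integrable_comp_sub_smul_mul hρ (hk.pd j) hε x).const_mul _).const_mul _
    · exact (integrable_comp_sub_smul_mul (hρu j) (hk.pd j) hε x).const_mul _
  simp only [e, Finset.sum_sub_distrib, ← Finset.mul_sum, h0, mul_zero, sub_zero]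

/-- Bound for the commutator kernel at fixed `z`, uniform in `ε`: one factor `‖z‖` comes from the
difference quotient of `v`. -/
theorem eLpNorm_commutator_le {a b : ℝ≥0∞} [ENNReal.HolderTriple a b 2] {w v : E3 → ℝ}
    {gv : Fin 3 → E3 → ℝ} {φv : ℕ → E3 → ℝ} (hw : MemLp w a volume) (hρ : MemLp ρ b volume)
    (hv : D12Approx φv v gv) (k : E3 → ℝ) {ε : ℝ} (hε : 0 < ε) (z : E3) :
    eLpNorm (fun x => w x * (ε⁻¹ * (v x - v (x - ε • z)) * ρ (x - ε • z) * k z)) 1 volume ≤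
      ‖k z‖ₑ * ‖z‖ₑ * (eLpNorm w a volume *
        (eLpNorm ρ b volume * ∑ i, eLpNorm (gv i) 2 volume)) := by
  have e : (fun x => w x * (ε⁻¹ * (v x - v (x - ε • z)) * ρ (x - ε • z) * k z)) =
      k z • fun x => (w x * ρ (x - ε • z)) * (ε⁻¹ * (v x - v (x - ε • z))) := by
    ext x
    simp only [Pi.smul_apply, smul_eq_mul]
    ring
  have m1 := (hw.1.mul (hρ.comp_sub_right (ε • z)).1)
  have m2 := ((hv.lim.memLp_lim.1.sub (hv.lim.memLp_lim.comp_sub_right (ε • z)).1).const_mul ε⁻¹)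
  rw [e, eLpNorm_const_smul, mul_assoc]
  refine mul_le_mul_right ?_ _
  refine (eLpNorm_mul_le (p := 2) (q := 2) m1 m2).trans ?_
  refine (mul_le_mul' (eLpNorm_mul_le (p := a) (q := b) hw.1 (hρ.comp_sub_right (ε • z)).1)
    (hv.eLpNorm_diffQuot_le z hε)).trans (le_of_eq ?_)
  rw [eLpNorm_comp_sub_right hρ.1]
  ring

theorem lintegral_commutator_weight (hk : IsTestFunction k) {M : ℝ≥0∞} (hM : M ≠ ⊤) :
    ∫⁻ z, ‖k z‖ₑ * ‖z‖ₑ * M < ⊤ := by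
  have hkz : Integrable (fun z => ‖k z‖ * ‖z‖) :=
    (hk.continuous.norm.mul continuous_norm).integrable_of_hasCompactSupport hk.2.norm.mul_right
  rw [lintegral_mul_const' _ _ hM]
  refine ENNReal.mul_lt_top (lt_of_eq_of_lt ?_ hkz.2) hM.lt_top
  simp [enorm_mul]

/-- The commutator kernel paired with a weight is integrable in both variables. -/
theorem integrable_commutator {a b : ℝ≥0∞} [ENNReal.HolderTriple a b 2] {w v : E3 → ℝ}
    {gv : Fin 3 → E3 → ℝ} {φv : ℕ → E3 → ℝ} (hw : MemLp w a volume) (hρ : MemLp ρ b volume)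
    (hv : D12Approx φv v gv) (hk : IsTestFunction k) {ε : ℝ} (hε : 0 < ε) :
    Integrable (Function.uncurry fun x z : E3 =>
      w x * (ε⁻¹ * (v x - v (x - ε • z)) * ρ (x - ε • z) * k z))
      ((volume : Measure E3).prod volume) := by
  have hm : AEStronglyMeasurable (Function.uncurry fun x z : E3 =>
      w x * (ε⁻¹ * (v x - v (x - ε • z)) * ρ (x - ε • z) * k z))
      ((volume : Measure E3).prod volume) := by
    have m1 := aestronglyMeasurable_comp_sub_smul hv.lim.memLp_lim.1 ε (volume : Measure E3)
    have m2 := aestronglyMeasurable_comp_sub_smul hρ.1 ε (volume : Measure E3)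
    exact hw.1.comp_fst.mul ((((hv.lim.memLp_lim.1.comp_fst.sub m1).const_mul ε⁻¹).mul m2).mul
      (hk.continuous.comp continuous_snd).aestronglyMeasurable)
  have hMt : eLpNorm w a volume * (eLpNorm ρ b volume * ∑ i, eLpNorm (gv i) 2 volume) ≠ ⊤ :=
    ENNReal.mul_ne_top hw.2.ne (ENNReal.mul_ne_top hρ.2.ne
      (ENNReal.sum_ne_top.2 fun i _ => (hv.lim_pd i).memLp_lim.2.ne))
  refine ⟨hm, ?_⟩
  rw [HasFiniteIntegral, lintegral_prod_symm _ hm.enorm]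
  refine (lintegral_mono fun z => ?_).trans_lt (lintegral_commutator_weight hk hMt)
  refine le_trans (le_of_eq ?_) (eLpNorm_commutator_le hw hρ hv k hε z)
  rw [eLpNorm_one_eq_lintegral_enorm]
  rfl

/-- Limit of the commutator paired with a convergent weight: `u` is differentiated. -/
theorem tendsto_integral_commutator {a b : ℝ≥0∞} [ENNReal.HolderTriple a b 2] (hb : 1 ≤ b)
    (ha : 1 ≤ a) (hb' : b ≠ ⊤) {w : ℕ → E3 → ℝ} {w' v : E3 → ℝ}
    {gv : Fin 3 → E3 → ℝ} {φv : ℕ → E3 → ℝ} (hw : LpLim a atTop w w') (hρ : MemLp ρ b volume)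
    (hv : D12Approx φv v gv) (hk : IsTestFunction k) {ε : ℕ → ℝ} (hε : ∀ n, 0 < ε n)
    (hε0 : Tendsto ε atTop (𝓝 0)) :
    Tendsto (fun n => ∫ x, w n x *
        ∫ z, (ε n)⁻¹ * (v x - v (x - ε n • z)) * ρ (x - ε n • z) * k z) atTop
      (𝓝 (∑ i, (∫ z : E3, z i * k z) * ∫ x, w' x * ρ x * gv i x)) := by
  set F : ℕ → E3 → E3 → ℝ := fun n x z =>
    w n x * ((ε n)⁻¹ * (v x - v (x - ε n • z)) * ρ (x - ε n • z) * k z) with hF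
  have hFi : ∀ n, Integrable (Function.uncurry (F n)) ((volume : Measure E3).prod volume) :=
    fun n => integrable_commutator (hw.memLp n) hρ hv hk (hε n)
  have e1 : ∀ n, ∫ x, w n x *
      ∫ z, (ε n)⁻¹ * (v x - v (x - ε n • z)) * ρ (x - ε n • z) * k z = ∫ z, ∫ x, F n x z := by
    intro n
    rw [← integral_integral_swap (hFi n)]
    simp only [hF, integral_const_mul]
  simp only [e1]
  set N := ∑ i, eLpNorm (gv i) 2 volume with hN
  have hNt : N ≠ ⊤ := ENNReal.sum_ne_top.2 fun i _ => (hv.lim_pd i).memLp_lim.2.ne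
  set M := (eLpNorm w' a volume + 1) * (eLpNorm ρ b volume * N) with hM
  have hMt : M ≠ ⊤ := ENNReal.mul_ne_top (by simp [hw.memLp_lim.2.ne])
    (ENNReal.mul_ne_top hρ.2.ne hNt)
  have hwev : ∀ᶠ n in atTop, eLpNorm (w n) a volume ≤ eLpNorm w' a volume + 1 :=
    ((hw.tendsto_eLpNorm ha).eventually_lt_const
      (ENNReal.lt_add_right hw.memLp_lim.2.ne one_ne_zero)).mono fun n hn => hn.le
  have hbt : ∀ z, ‖k z‖ₑ * ‖z‖ₑ * M ≠ ⊤ := fun z =>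
    ENNReal.mul_ne_top (ENNReal.mul_ne_top (by simp) (by simp)) hMt
  have hlim : ∀ z, Tendsto (fun n => ∫ x, F n x z) atTop
      (𝓝 (∫ x, k z * ((w' x * ρ x) * ∑ i, z i * gv i x))) := by
    intro z
    have h0 : Tendsto (fun n => ε n • z) atTop (𝓝 0) := by simpa using hε0.smul_const z
    have t1 : LpLim 2 atTop (fun n x => w n x * ρ (x - ε n • z)) (fun x => w' x * ρ x) :=
      hw.mul (by norm_num) ((LpLim.translate hb hb' hρ).comp h0)
    have t2 := ((t1.mul (r := 1) le_rfl (hv.lpLim_diffQuot z hε hε0)).const_mul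
      (k z)).tendsto_integral
    refine t2.congr fun n => ?_
    congr 1
    ext x
    simp only [hF]
    ring
  have hdct := tendsto_integral_filter_of_dominated_convergence (l := atTop)
    (F := fun n z => ∫ x, F n x z) (μ := (volume : Measure E3))
    (fun z => (‖k z‖ₑ * ‖z‖ₑ * M).toReal)
    (Eventually.of_forall fun n => (hFi n).integral_prod_right.1)
    (hwev.mono fun n hn => Eventually.of_forall fun z => ?_)
    (integrable_toReal_of_lintegral_ne_top ?_ (lintegral_commutator_weight hk hMt).ne)
    (Eventually.of_forall hlim)
  · refine hdct.trans (le_of_eq ?_)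
    congr 1
    have hgi : ∀ i, Integrable (fun x => w' x * ρ x * gv i x) := fun i =>
      memLp_one_iff_integrable.1 ((hv.lim_pd i).memLp_lim.mul' (p := 2) (q := 2)
        (hρ.mul' (p := a) (q := b) (r := 2) hw.memLp_lim))
    have e2 : ∀ z : E3, ∫ x, k z * ((w' x * ρ x) * ∑ i, z i * gv i x) =
        ∑ i, (z i * k z) * ∫ x, w' x * ρ x * gv i x := by
      intro z
      simp only [← integral_const_mul]
      rw [← integral_finsetSum _ fun i _ => (hgi i).const_mul _]
      congr 1
      ext x
      simp only [Finset.mul_sum]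
      refine Finset.sum_congr rfl fun i _ => ?_
      ring
    simp only [e2]
    rw [integral_finsetSum _ fun i _ => ?_]
    · simp only [integral_mul_const]
    · refine Integrable.mul_const ?_ _
      exact ((EuclideanSpace.proj (𝕜 := ℝ) i).continuous.mul
        hk.continuous).integrable_of_hasCompactSupport hk.2.mul_left
  · rw [← toReal_enorm]
    refine ENNReal.toReal_mono (hbt z) ((enorm_integral_le_lintegral_enorm _).trans ?_)
    rw [← eLpNorm_one_eq_lintegral_enorm]
    refine (eLpNorm_commutator_le (a := a) (b := b) (hw.memLp n) hρ hv k (hε n) z).trans ?_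
    exact mul_le_mul' le_rfl (mul_le_mul' hn le_rfl)
  · exact ((hk.continuous.enorm.measurable.mul measurable_enorm).mul_const _).aemeasurable

/-- Renormalisation of the continuity equation with `b(ρ) = ρ^γ`, integrated over `ℝ³`:
`∫ ρ^γ div u = 0`. -/
theorem integral_rpow_mul_div_eq_zero {γ : ℝ} (hγ : 2 < γ) (hρ0 : ∀ x, 0 ≤ ρ x)
    (hρ1 : MemLp ρ (ENNReal.ofReal γ) volume) (hρ2 : MemLp ρ (ENNReal.ofReal (2 * γ)) volume)
    (hu : ∀ j, D12Approx (φ j) (u j) (g j))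
    (hρu : ∀ j, LocallyIntegrable (fun x => ρ x * u j x) volume)
    (hmass : ∀ ψ, IsTestFunction ψ → ∫ x, ∑ j, ρ x * u j x * pd j ψ x = 0) :
    ∑ j, ∫ x, ρ x ^ γ * g j j x = 0 := by
  obtain ⟨k, hk, hk0, hk1⟩ := exists_mollifier
  set ε : ℕ → ℝ := fun n => 1 / ((n : ℝ) + 1) with hεdef
  have hε : ∀ n, 0 < ε n := fun n => by positivity
  have hε0 : Tendsto ε atTop (𝓝 0) := tendsto_one_div_add_atTop_nhds_zero_nat (𝕜 := ℝ)
  have one_le : ∀ {t : ℝ}, 1 ≤ t → 1 ≤ ENNReal.ofReal t := fun {t} ht => by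
    rw [← ENNReal.ofReal_one]
    exact ENNReal.ofReal_le_ofReal ht
  have hγ1 : (1 : ℝ≥0∞) ≤ ENNReal.ofReal γ := one_le (by linarith)
  have hγ2 : (1 : ℝ≥0∞) ≤ ENNReal.ofReal (2 * γ) := one_le (by linarith)
  have hρl : LocallyIntegrable ρ volume := hρ1.locallyIntegrable hγ1
  set r : ℕ → E3 → ℝ := fun n => conv ρ (rescale (ε n) k) with hr
  have hκ : ∀ n, IsTestFunction (rescale (ε n) k) := fun n => hk.rescale (hε n)
  have hr0 : ∀ n x, 0 ≤ r n x := fun n x => integral_nonneg fun y =>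
    mul_nonneg (hρ0 y) (mul_nonneg (by have := hε n; positivity) (hk0 _))
  have hrs : ∀ n, ContDiff ℝ ∞ (r n) := fun n => contDiff_conv hρl (hκ n)
  have hrlim : LpLim (ENNReal.ofReal (2 * γ)) atTop r ρ :=
    LpLim.mollify hγ2 ENNReal.ofReal_ne_top hρ2 hk hk1 hε hε0
  have hw : LpLim (ENNReal.ofReal (2 * γ / (γ - 1))) atTop (fun n x => r n x ^ (γ - 1))
      (fun x => ρ x ^ (γ - 1)) := hrlim.rpow (by linarith) (by linarith) rfl hr0 hρ0
  have hP : LpLim 2 atTop (fun n x => r n x ^ γ) (fun x => ρ x ^ γ) := by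
    have := hrlim.rpow (b := γ) (c := 2) (by linarith) (by linarith)
      (by field_simp) hr0 hρ0
    simpa using this
  have hhol : ENNReal.HolderTriple (ENNReal.ofReal (2 * γ / (γ - 1)))
      (ENNReal.ofReal (2 * γ)) 2 := by
    have := holderTriple_ofReal (a := 2 * γ / (γ - 1)) (b := 2 * γ) (c := 2)
      (div_pos (by linarith) (by linarith)) (by linarith) (by norm_num) (by
        field_simp
        ring)
    simpa using this
  -- The chain rule makes `ρ_ε^{γ-1} u · ∇ρ_ε` a multiple of `u · ∇(ρ_ε^γ)`.
  have hpdr : ∀ n j x, pd j (fun x => r n x ^ γ) x = γ * (r n x ^ (γ - 1) * pd j (r n) x) := by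
    intro n j x
    have h1 := ((hrs n).differentiable (by simp) x).hasFDerivAt.rpow_const
      (p := γ) (Or.inr (by linarith))
    rw [HasFDerivAt.pd_eq h1]
    simp [pd_eq_fderiv, mul_assoc]
  have hC1 : ∀ n, ContDiff ℝ 1 (fun x => r n x ^ γ) := fun n =>
    (show ContDiff ℝ 1 (r n) from (hrs n).of_le (by exact_mod_cast le_top)).rpow_const_of_le
      (m := 1) (by push_cast; linarith)
  have hmem : ∀ n j, MemLp (pd j (fun x => r n x ^ γ)) (6 / 5) volume := by
    intro n j
    have hconj : ENNReal.HolderTriple (ENNReal.ofReal γ) (ENNReal.ofReal (γ / (γ - 1))) 1 := by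
      have := holderTriple_ofReal (a := γ) (b := γ / (γ - 1)) (c := 1)
        (by linarith) (div_pos (by linarith) (by linarith)) (by norm_num) (by
          field_simp
          ring)
      simpa using this
    have m1 := memLp_conv hγ1 (by simp) hρ1 (hκ n)
    have m2 := memLp_rpow_of_nonneg (b := γ - 1) (by linarith) rfl m1 (hr0 n)
    have hpd : pd j (r n) = conv ρ (pd j (rescale (ε n) k)) := pd_conv hρl (hκ n) j
    have m3 := memLp_conv hγ1 (by simp) hρ1 ((hκ n).pd j)
    have b1 := abs_conv_le (q := ENNReal.ofReal (γ / (γ - 1))) hρ1 (hκ n)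
    have b2 := abs_conv_le (q := ENNReal.ofReal (γ / (γ - 1))) hρ1 ((hκ n).pd j)
    have m4 : MemLp (fun x => γ * (conv ρ (pd j (rescale (ε n) k)) x * r n x ^ (γ - 1))) 1 volume :=
      (m2.mul' (p := ENNReal.ofReal γ) m3).const_mul γ
    have e : pd j (fun x => r n x ^ γ) =
        fun x => γ * (conv ρ (pd j (rescale (ε n) k)) x * r n x ^ (γ - 1)) := by
      ext x
      rw [hpdr, hpd, mul_comm (r n x ^ (γ - 1))]
    rw [e]
    set B1 := (eLpNorm ρ (ENNReal.ofReal γ) volume *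
      eLpNorm (rescale (ε n) k) (ENNReal.ofReal (γ / (γ - 1))) volume).toReal
    set B2 := (eLpNorm ρ (ENNReal.ofReal γ) volume *
      eLpNorm (pd j (rescale (ε n) k)) (ENNReal.ofReal (γ / (γ - 1))) volume).toReal
    refine memLp_of_bounded_of_le (a := 1) (by simp) (by simp) ?_ ?_ m4
      (C := γ * (B2 * B1 ^ (γ - 1))) fun x => ?_
    · rw [ENNReal.le_div_iff_mul_le (by simp) (by simp)]
      norm_num
    · exact ENNReal.div_ne_top (by simp) (by simp)
    · rw [abs_mul, abs_mul, abs_of_pos (by linarith : 0 < γ),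
        abs_of_nonneg (Real.rpow_nonneg (hr0 n x) _)]
      have h1 : r n x ≤ B1 := (le_abs_self _).trans (b1 x)
      have := b2 x
      have h3 := hr0 n x
      have h4 : 0 ≤ γ - 1 := by linarith
      gcongr
  set S := ∑ j, ∫ x, ρ x ^ γ * g j j x with hS
  set A : ℕ → ℝ := fun n => ∑ j, ∫ x, r n x ^ (γ - 1) * (u j x * pd j (r n) x) with hA
  have hA1 : Tendsto (fun n => γ * A n) atTop (𝓝 (-S)) := by
    have e : ∀ n, γ * A n = - ∑ j, ∫ x, r n x ^ γ * g j j x := by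
      intro n
      rw [hA, Finset.mul_sum, ← Finset.sum_neg_distrib]
      refine Finset.sum_congr rfl fun j _ => ?_
      rw [← (hu j).integral_mul_pd (hC1 n) (hP.memLp n) j (hmem n j), ← integral_const_mul]
      congr 1
      ext x
      rw [hpdr]
      ring
    simp only [e]
    exact (tendsto_finsetSum _ fun j _ =>
      (hP.mul (r := 1) le_rfl (LpLim.const ((hu j).lim_pd j).memLp_lim)).tendsto_integral).neg
  -- By the mass balance the same quantity is a commutator.
  have hA2 : Tendsto A atTop (𝓝 (-S)) := by
    have hint : ∀ n j, Integrable (fun x => r n x ^ (γ - 1) * (u j x * pd j (r n) x)) := by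
      intro n j
      have i65 : ENNReal.HolderTriple 6 (6 / 5) 1 := holderTriple_of_toReal (by simp) (by simp)
        (by simp) (by simp; norm_num)
      have := memLp_one_iff_integrable.1
        ((hmem n j).mul' (p := 6) (r := 1) (hu j).lim.memLp_lim)
      refine (this.const_mul γ⁻¹).congr (Eventually.of_forall fun x => ?_)
      simp only [hpdr]
      field_simp [(by linarith : γ ≠ 0)]
    have hint2 : ∀ n j, Integrable (fun x => r n x ^ (γ - 1) * ∫ z, (ε n)⁻¹ *
        (u j x - u j (x - ε n • z)) * ρ (x - ε n • z) * pd j k z) := by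
      intro n j
      have := (integrable_commutator (hw.memLp n) hρ2 (hu j) (hk.pd j) (hε n)).integral_prod_left
      refine this.congr (Eventually.of_forall fun x => ?_)
      simp only [Function.uncurry_apply_pair, integral_const_mul]
    have e : ∀ n, A n = ∑ j, ∫ x, r n x ^ (γ - 1) * ∫ z, (ε n)⁻¹ *
        (u j x - u j (x - ε n • z)) * ρ (x - ε n • z) * pd j k z := by
      intro n
      rw [hA]
      beta_reduce
      rw [← integral_finsetSum _ fun j _ => hint n j, ← integral_finsetSum _ fun j _ => hint2 n j]
      congr 1
      ext x
      rw [← Finset.mul_sum, ← Finset.mul_sum, sum_mul_pd_mollify hρl hρu hmass hk (hε n)]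
    refine Tendsto.congr (fun n => (e n).symm) ?_
    have ha1 : (1 : ℝ≥0∞) ≤ ENNReal.ofReal (2 * γ / (γ - 1)) := one_le (by
      rw [le_div_iff₀ (by linarith)]
      linarith)
    have := tendsto_finsetSum Finset.univ fun j _ =>
      tendsto_integral_commutator hγ2 ha1 ENNReal.ofReal_ne_top hw hρ2 (hu j) (hk.pd j) hε hε0
    refine this.trans (le_of_eq ?_)
    congr 1
    rw [hS, ← Finset.sum_neg_distrib]
    refine Finset.sum_congr rfl fun j _ => ?_
    simp only [integral_coord_mul_pd hk hk1]
    rw [Finset.sum_eq_single j (fun i _ hij => by simp [hij]) (by simp)]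
    simp only [if_true, neg_one_mul]
    congr 2
    ext x
    congr 1
    rcases (hρ0 x).eq_or_lt with h | h
    · rw [← h, mul_zero, Real.zero_rpow (by linarith)]
    · rw [← Real.rpow_add_one h.ne', sub_add_cancel]
  have := tendsto_nhds_unique hA1 (hA2.const_mul γ)
  nlinarith

end transport

/-! ### Energy identity -/

theorem viscousStress_apply (μ η : ℝ) (A : Matrix (Fin 3) (Fin 3) ℝ) (i j : Fin 3) :
    viscousStress μ η A i j =
      μ * (A i j + A j i) +
        (η - 2 / 3 * μ) * ((∑ k, A k k) * (1 : Matrix (Fin 3) (Fin 3) ℝ) i j) := by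
  simp only [viscousStress, Matrix.trace, Matrix.diag, Matrix.add_apply, Matrix.sub_apply,
    Matrix.smul_apply, Matrix.transpose_apply, smul_eq_mul]
  ring

namespace IsWeakSolution

variable {μ η : ℝ} {p : ℝ → ℝ} {G ρ : E3 → ℝ} {u : E3 → E3}

/-- The mass balance in coordinates. -/
theorem mass_balance_pd (h : IsWeakSolution μ η p G ρ u) {ψ : E3 → ℝ} (hψ : IsTestFunction ψ) :
    ∫ x, ∑ j, ρ x * u x j * pd j ψ x = 0 := by
  rw [← h.mass_balance ψ hψ]
  congr 1
  ext x
  simp only [PiLp.inner_apply, PiLp.smul_apply, smul_eq_mul, RCLike.inner_apply, conj_trivial, pd]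
  exact Finset.sum_congr rfl fun j _ => mul_comm _ _

/-- The momentum balance in coordinates, solved for the pressure; the integrability hypotheses are
what allows the integrals to be split. -/
theorem momentum_balance_pd (h : IsWeakSolution μ η p G ρ u)
    (hP : MemLp (fun x => p (ρ x)) 1 volume)
    (hT : ∀ i j, MemLp (fun x => ρ x * u x i * u x j) 2 volume)
    (hS : ∀ i j, MemLp (fun x => viscousStress μ η (weakJacobian u x) i j) 2 volume)
    (hF : ∀ i, MemLp (fun x => ρ x * weakGradient G x i) (6 / 5) volume)
    {Φ : Fin 3 → E3 → ℝ} (hΦ : ∀ i, IsTestFunction (Φ i)) :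
    ∫ x, p (ρ x) * ∑ i, pd i (Φ i) x =
      (∑ i, ∑ j, ∫ x, (viscousStress μ η (weakJacobian u x) i j - ρ x * u x i * u x j) *
        pd j (Φ i) x) - ∑ i, ∫ x, ρ x * weakGradient G x i * Φ i x := by
  have i65 : ENNReal.HolderTriple (6 / 5) 6 1 := holderTriple_of_toReal (by simp) (by simp)
    (by simp) (by simp; norm_num)
  set v : E3 → E3 := fun x => WithLp.toLp 2 fun i => Φ i x with hv
  have hv1 : ContDiff ℝ 1 v := contDiff_euclidean.2 fun i => (hΦ i).contDiff'
  have hv2 : HasCompactSupport v := by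
    refine HasCompactSupport.of_support_subset_isCompact
      (isCompact_iUnion fun i => (hΦ i).2.isCompact) fun x hx => ?_
    by_contra hn
    simp only [Set.mem_iUnion, not_exists] at hn
    refine hx ?_
    ext i
    exact (image_eq_zero_of_notMem_tsupport (hn i) : Φ i x = 0)
  have hjac : ∀ x i j, jacobian v x i j = pd j (Φ i) x := fun x i j => rfl
  have key := h.momentum_balance v hv1 hv2
  have iP : Integrable (fun x => p (ρ x) * ∑ i, pd i (Φ i) x) := by
    have hd : IsTestFunction (fun x => ∑ i, pd i (Φ i) x) :=
      IsTestFunction.sum Finset.univ fun i _ => (hΦ i).pd i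
    exact memLp_one_iff_integrable.1 ((hd.memLp ⊤).mul' (p := 1) (r := 1) hP)
  have iT : ∀ i j, Integrable (fun x => ρ x * u x i * u x j * pd j (Φ i) x) := fun i j =>
    memLp_one_iff_integrable.1 ((((hΦ i).pd j).memLp 2).mul' (p := 2) (r := 1) (hT i j))
  have iS : ∀ i j, Integrable (fun x => viscousStress μ η (weakJacobian u x) i j * pd j (Φ i) x) :=
    fun i j => memLp_one_iff_integrable.1
      ((((hΦ i).pd j).memLp 2).mul' (p := 2) (r := 1) (hS i j))
  have iF : ∀ i, Integrable (fun x => ρ x * weakGradient G x i * Φ i x) := fun i =>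
    memLp_one_iff_integrable.1 (((hΦ i).memLp 6).mul' (p := 6 / 5) (r := 1) (hF i))
  have e1 : ∫ x, (ρ x * frob (tensorSq (u x)) (jacobian v x) + p (ρ x) * (jacobian v x).trace) =
      (∑ i, ∑ j, ∫ x, ρ x * u x i * u x j * pd j (Φ i) x) +
        ∫ x, p (ρ x) * ∑ i, pd i (Φ i) x := by
    have : ∀ i, ∑ j, ∫ x, ρ x * u x i * u x j * pd j (Φ i) x =
        ∫ x, ∑ j, ρ x * u x i * u x j * pd j (Φ i) x := fun i =>
      (integral_finsetSum _ fun j _ => iT i j).symm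
    simp only [this]
    rw [← integral_finsetSum _ fun i _ => integrable_finsetSum _ fun j _ => iT i j,
      ← integral_add
        (integrable_finsetSum _ fun i _ => integrable_finsetSum _ fun j _ => iT i j) iP]
    congr 1
    ext x
    congr 1
    · simp only [frob, tensorSq, Matrix.of_apply, hjac, Finset.mul_sum]
      exact Finset.sum_congr rfl fun i _ => Finset.sum_congr rfl fun j _ => by ring
  have e2 : ∫ x, frob (viscousStress μ η (weakJacobian u x)) (jacobian v x) =
      ∑ i, ∑ j, ∫ x, viscousStress μ η (weakJacobian u x) i j * pd j (Φ i) x := by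
    simp only [frob, hjac]
    rw [integral_finsetSum _ fun i _ => integrable_finsetSum _ fun j _ => iS i j]
    exact Finset.sum_congr rfl fun i _ => integral_finsetSum _ fun j _ => iS i j
  have e3 : ∫ x, inner ℝ (ρ x • weakGradient G x) (v x) =
      ∑ i, ∫ x, ρ x * weakGradient G x i * Φ i x := by
    rw [← integral_finsetSum _ fun i _ => iF i]
    congr 1
    ext x
    simp only [PiLp.inner_apply, PiLp.smul_apply, smul_eq_mul, RCLike.inner_apply, conj_trivial, hv]
    exact Finset.sum_congr rfl fun j _ => mul_comm _ _
  rw [e1, e2, e3] at key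
  have e4 : ∀ i j, ∫ x, (viscousStress μ η (weakJacobian u x) i j - ρ x * u x i * u x j) *
      pd j (Φ i) x = (∫ x, viscousStress μ η (weakJacobian u x) i j * pd j (Φ i) x) -
        ∫ x, ρ x * u x i * u x j * pd j (Φ i) x := fun i j => by
    rw [← integral_sub (iS i j) (iT i j)]
    simp only [sub_mul]
  simp only [e4, Finset.sum_sub_distrib]
  linarith

end IsWeakSolution

/-- `∫ ∂ᵢf ∂ⱼf' = ∫ ∂ⱼf ∂ᵢf'` for `D₀^{1,2}` functions. -/
theorem D12Approx.integral_mul_comm {φ ψ : ℕ → E3 → ℝ} {f f' : E3 → ℝ} {g g' : Fin 3 → E3 → ℝ}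
    (h : D12Approx φ f g) (h' : D12Approx ψ f' g') (i j : Fin 3) :
    ∫ x, g i x * g' j x = ∫ x, g j x * g' i x := by
  have t1 := ((h.lim_pd i).mul (r := 1) le_rfl (h'.lim_pd j)).tendsto_integral
  have t2 := ((h.lim_pd j).mul (r := 1) le_rfl (h'.lim_pd i)).tendsto_integral
  refine tendsto_nhds_unique t1 (t2.congr fun n => ?_)
  exact integral_pd_mul_pd_comm (h.test n) (h'.test n) j i

/-- Coercivity of the dissipation: if `∫ S(∇u) : ∇u = 0` then `∇u = 0`. Pointwise, `S(∇u) : ∇u` only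
controls the trace-free symmetric part of `∇u`; the full gradient is recovered from
`∫ ∂ⱼuᵢ ∂ᵢuⱼ = ∫ |div u|²`. -/
theorem ae_eq_zero_of_dissipation_eq_zero {μ η : ℝ} (hμ : 0 < μ) (hη : 0 ≤ η)
    {u : Fin 3 → E3 → ℝ} {A : Fin 3 → Fin 3 → E3 → ℝ} {φ : Fin 3 → ℕ → E3 → ℝ}
    (hu : ∀ i, D12Approx (φ i) (u i) (A i))
    (h : ∑ i, ∑ j, ∫ x, viscousStress μ η (Matrix.of fun i j => A i j x) i j * A i j x = 0)
    (i j : Fin 3) : A i j =ᵐ[volume] 0 := by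
  have hA : ∀ i j, MemLp (A i j) 2 volume := fun i j => ((hu i).lim_pd j).memLp_lim
  have hAA : ∀ a b c d, Integrable (fun x => A a b x * A c d x) := fun a b c d =>
    (hA a b).integrable_mul (hA c d)
  have e : ∀ i j, ∫ x, viscousStress μ η (Matrix.of fun i j => A i j x) i j * A i j x =
      μ * ((∫ x, A i j x * A i j x) + ∫ x, A i i x * A j j x) +
        (η - 2 / 3 * μ) * ((1 : Matrix (Fin 3) (Fin 3) ℝ) i j * ∑ k, ∫ x, A k k x * A i j x) := by
    intro i j
    have hs := (hu j).integral_mul_comm (hu i) i j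
    have hs' : ∫ x, A i i x * A j j x = ∫ x, A j i x * A i j x := by
      rw [hs]
      exact integral_congr_ae (Eventually.of_forall fun x => mul_comm _ _)
    rw [hs', ← integral_finsetSum _ fun k _ => hAA k k i j,
      ← integral_add (hAA _ _ _ _) (hAA _ _ _ _),
      ← integral_const_mul, ← integral_const_mul, ← integral_const_mul, ← integral_add]
    · congr 1
      ext x
      rw [viscousStress_apply, ← Finset.sum_mul]
      simp only [Matrix.of_apply]
      ring
    · exact ((hAA _ _ _ _).add (hAA _ _ _ _)).const_mul _
    · exact ((integrable_finsetSum _ fun k _ => hAA k k i j).const_mul _).const_mul _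
  set T : ℝ := ∫ x, (∑ k, A k k x) * ∑ k, A k k x with hT
  have hT0 : 0 ≤ T := integral_nonneg fun x => mul_self_nonneg _
  have hTe : T = ∑ i, ∑ j, ∫ x, A i i x * A j j x := by
    rw [hT]
    simp only [Finset.sum_mul_sum]
    rw [integral_finsetSum _ fun i _ => integrable_finsetSum _ fun j _ => hAA _ _ _ _]
    exact Finset.sum_congr rfl fun i _ => integral_finsetSum _ fun j _ => hAA _ _ _ _
  have hTe' : ∑ i, ∑ j, (1 : Matrix (Fin 3) (Fin 3) ℝ) i j * ∑ k, ∫ x, A k k x * A i j x = T := by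
    rw [hTe, Finset.sum_comm]
    simp only [Matrix.one_apply, ite_mul, one_mul, zero_mul, Finset.sum_ite_eq', Finset.mem_univ,
      if_true]
    rw [Finset.sum_comm]
  simp only [e, Finset.sum_add_distrib, ← Finset.mul_sum] at h
  rw [hTe', ← hTe] at h
  have hnn : ∀ i j, 0 ≤ ∫ x, A i j x * A i j x := fun i j =>
    integral_nonneg fun x => mul_self_nonneg _
  have hle : ∫ x, A i j x * A i j x ≤ ∑ i, ∑ j, ∫ x, A i j x * A i j x :=
    (Finset.single_le_sum (f := fun j => ∫ x, A i j x * A i j x) (fun b _ => hnn i b)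
      (Finset.mem_univ j)).trans
    (Finset.single_le_sum (f := fun i => ∑ j, ∫ x, A i j x * A i j x)
      (fun a _ => Finset.sum_nonneg fun b _ => hnn a b) (Finset.mem_univ i))
  have h0 : ∫ x, A i j x * A i j x = 0 := by
    refine le_antisymm (hle.trans ?_) (hnn i j)
    have : 0 ≤ η * T := mul_nonneg hη hT0
    have : 0 ≤ μ * T := mul_nonneg hμ.le hT0
    nlinarith
  have := (integral_eq_zero_iff_of_nonneg (fun x => mul_self_nonneg _) (hAA i j i j)).1 h0
  filter_upwards [this] with x hx using mul_self_eq_zero.1 hx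

theorem theorem5 (μ η : ℝ) (hμ : 0 < μ) (hη : 0 ≤ η) (γ q : ℝ) (hγ : 6 ≤ γ)
    (hq₁ : 6 * γ / (5 * γ - 6) ≤ q) (hq₂ : q ≤ 3 / 2)
    (G : E3 → ℝ) (hG : MemD10 (ENNReal.ofReal q) G)
    (ρ : E3 → ℝ) (u : E3 → E3)
    (hsol : IsWeakSolution μ η (fun s => s ^ γ) G ρ u)
    (hρ₆ : MemLp ρ 6 volume) (hργ : MemLp ρ (ENNReal.ofReal γ) volume) :
    ∀ᵐ x, u x = 0 := by
  choose φ hφ using fun i => (hsol.memD10_velocity i).exists_d12Approx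
  obtain ⟨ψ, hψ, hψG, -⟩ := hG.exists_lpLim_pd
  have hu6 : ∀ i, MemLp (fun x => u x i) 6 volume := fun i => (hφ i).lim.memLp_lim
  set A : Fin 3 → Fin 3 → E3 → ℝ := fun i k x => weakGradient (fun y => u y i) x k with hA
  have hA2 : ∀ i j, MemLp (A i j) 2 volume := fun i j => ((hφ i).lim_pd j).memLp_lim
  have hGq : ∀ i, MemLp (fun x => weakGradient G x i) (ENNReal.ofReal q) volume := fun i =>
    (hψG i).memLp_lim
  have h663 : ENNReal.HolderTriple 6 6 3 := holderTriple_of_toReal (by simp) (by simp) (by simp)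
    (by simp; norm_num)
  have h362 : ENNReal.HolderTriple 3 6 2 := holderTriple_of_toReal (by simp) (by simp) (by simp)
    (by simp; norm_num)
  have h62 : ENNReal.HolderTriple 6 2 (3 / 2) := holderTriple_of_toReal (by simp) (by simp)
    (by simp) (by simp; norm_num)
  have h331 : ENNReal.HolderTriple 3 (3 / 2) 1 := holderTriple_of_toReal (by simp) (by simp)
    (by simp) (by simp; norm_num)
  have i65 : ENNReal.HolderTriple (6 / 5) 6 1 := holderTriple_of_toReal (by simp) (by simp)
    (by simp) (by simp; norm_num)
  have h32 : (1 : ℝ≥0∞) ≤ 3 / 2 := by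
    rw [ENNReal.le_div_iff_mul_le (by simp) (by simp)]
    norm_num
  -- The density is in `L^r` with `1/r + 1/q = 5/6`, so that the force `ρ ∇G` is in `L^{6/5}`.
  have hγ0 : 0 < 5 * γ - 6 := by linarith
  have hqγ : 6 * γ ≤ q * (5 * γ - 6) := (div_le_iff₀ hγ0).1 hq₁
  have hq65 : 0 < 5 * q - 6 := by nlinarith
  set r : ℝ := 6 * q / (5 * q - 6) with hr
  have hr6 : 6 ≤ r := by
    rw [hr, le_div_iff₀ hq65]
    linarith
  have hrγ : r ≤ γ := by
    rw [hr, div_le_iff₀ hq65]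
    linarith
  have hq0 : 0 < q := by linarith
  have hρr : MemLp ρ (ENNReal.ofReal r) volume := by
    refine memLp_of_le_of_le (a := 6) (b := ENNReal.ofReal γ) (by simp) ?_
      (ENNReal.ofReal_le_ofReal hrγ) (by simp) hρ₆ hργ
    simpa using ENNReal.ofReal_le_ofReal hr6
  have hrq : ENNReal.HolderTriple (ENNReal.ofReal r) (ENNReal.ofReal q) (6 / 5) := by
    refine holderTriple_of_toReal (by simp; linarith) (by simp; linarith) (by simp) ?_
    rw [ENNReal.toReal_ofReal (by linarith), ENNReal.toReal_ofReal hq0.le, hr]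
    simp only [ENNReal.toReal_div, ENNReal.toReal_ofNat]
    field_simp
    ring
  have hrs : ENNReal.HolderTriple (ENNReal.ofReal r) 6 (ENNReal.ofReal (q / (q - 1))) := by
    have hq1 : 0 < q - 1 := by linarith
    refine holderTriple_of_toReal (by simp; linarith) (by simp) (by simp; positivity) ?_
    rw [ENNReal.toReal_ofReal (by linarith), ENNReal.toReal_ofReal (by positivity), hr]
    simp only [ENNReal.toReal_ofNat]
    field_simp
    ring
  have hsq : ENNReal.HolderTriple (ENNReal.ofReal (q / (q - 1))) (ENNReal.ofReal q) 1 := by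
    have hq1 : 0 < q - 1 := by linarith
    refine holderTriple_of_toReal (by simp; positivity) (by simp; linarith) (by simp) ?_
    rw [ENNReal.toReal_ofReal hq0.le, ENNReal.toReal_ofReal (by positivity)]
    simp only [ENNReal.toReal_one]
    field_simp
    ring
  have hF : ∀ i, MemLp (fun x => ρ x * weakGradient G x i) (6 / 5) volume := fun i =>
    (hGq i).mul' hρr
  have hρu : ∀ j, MemLp (fun x => ρ x * u x j) 3 volume := fun j => (hu6 j).mul' hρ₆
  have hT : ∀ i j, MemLp (fun x => ρ x * u x i * u x j) 2 volume := fun i j =>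
    (hu6 j).mul' (hρu i)
  have hS : ∀ i j, MemLp (fun x => viscousStress μ η (weakJacobian u x) i j) 2 volume := by
    intro i j
    simp only [viscousStress_apply]
    exact (((hA2 i j).add (hA2 j i)).const_mul μ).add
      (((memLp_finsetSum _ fun k _ => hA2 k k).mul_const _).const_mul _)
  -- `ρ ≥ 0` only almost everywhere, so `|ρ|` serves as a nonnegative representative.
  set ρ' : E3 → ℝ := fun x => |ρ x| with hρ'
  have hρ'0 : ∀ x, 0 ≤ ρ' x := fun x => abs_nonneg _
  have hρρ' : ρ' =ᵐ[volume] ρ := by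
    filter_upwards [hsol.density_nonneg] with x hx using abs_of_nonneg hx
  have hP' : (fun x => ρ' x ^ γ) =ᵐ[volume] fun x => ρ x ^ γ := by
    filter_upwards [hρρ'] with x hx using by rw [hx]
  have hρ'γ : MemLp ρ' (ENNReal.ofReal γ) volume := hργ.ae_eq hρρ'.symm
  have hP1 : MemLp (fun x => ρ x ^ γ) 1 volume := by
    have := memLp_rpow_of_nonneg (b := γ) (c := 1) (by linarith)
      (by rw [div_self (by linarith)]) hρ'γ hρ'0
    rw [ENNReal.ofReal_one] at this
    exact this.ae_eq hP'
  have hmom := fun (Φ : Fin 3 → E3 → ℝ) (hΦ : ∀ i, IsTestFunction (Φ i)) =>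
    hsol.momentum_balance_pd hP1 hT hS hF hΦ
  have hH : ∀ i j, MemLp (fun x => viscousStress μ η (weakJacobian u x) i j -
      ρ x * u x i * u x j) 2 volume := fun i j => (hS i j).sub (hT i j)
  -- Thanks to `ρ^γ ∈ L²` the density is in `L^{2γ}`, as the renormalisation requires.
  have hP2 : MemLp (fun x => ρ x ^ γ) 2 volume := memLp_two_of_weak_gradient hP1 hH hF hmom
  have hρ'2γ : MemLp ρ' (ENNReal.ofReal (2 * γ)) volume := by
    have h2 : MemLp (fun x => ρ' x ^ γ) (ENNReal.ofReal 2) volume := by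
      simpa using hP2.ae_eq hP'.symm
    have := memLp_rpow_of_nonneg (b := γ⁻¹) (c := 2 * γ) (by positivity) (by field_simp) h2
      fun x => Real.rpow_nonneg (hρ'0 x) _
    refine this.ae_eq (Eventually.of_forall fun x => ?_)
    exact Real.rpow_rpow_inv (hρ'0 x) (by linarith)
  -- The power of the pressure vanishes.
  have hpress : ∑ i, ∫ x, ρ x ^ γ * A i i x = 0 := by
    have := integral_rpow_mul_div_eq_zero (γ := γ) (u := fun j x => u x j) (by linarith) hρ'0
      hρ'γ hρ'2γ hφ (fun j => by
        refine (((hρu j).locallyIntegrable (by norm_num))).congr ?_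
        filter_upwards [hρρ'] with x hx using by rw [hx]) fun ψ hψ => by
        rw [← hsol.mass_balance_pd hψ]
        refine integral_congr_ae ?_
        filter_upwards [hρρ'] with x hx using by simp only [hx]
    rw [← this]
    refine Finset.sum_congr rfl fun i _ => integral_congr_ae ?_
    filter_upwards [hP'] with x hx
    rw [← hx]
  -- The power of the force vanishes: `G` is a limit of test functions for the mass balance.
  have hforce : ∑ i, ∫ x, ρ x * weakGradient G x i * u x i = 0 := by
    have hm : ∀ j, MemLp (fun x => ρ x * u x j) (ENNReal.ofReal (q / (q - 1))) volume :=
      fun j => (hu6 j).mul' hρr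
    have hl := (LpLim.sum Finset.univ le_rfl fun j _ => (LpLim.const (l := atTop) (hm j)).mul
      (r := 1) le_rfl (hψG j))
    have ht := hl.tendsto_integral
    simp only [hsol.mass_balance_pd (hψ _)] at ht
    have h0 := tendsto_nhds_unique ht tendsto_const_nhds
    rw [integral_finsetSum _ fun j _ => memLp_one_iff_integrable.1
      ((hGq j).mul' (p := ENNReal.ofReal (q / (q - 1))) (r := 1) (hm j))] at h0
    rw [← h0]
    refine Finset.sum_congr rfl fun i _ => ?_
    congr 1
    ext x
    ring
  -- The power of the convective term vanishes: `|φ i n|²` is a test function for the mass balance.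
  have hconv : ∀ i, ∑ j, ∫ x, ρ x * u x i * u x j * A i j x = 0 := by
    intro i
    have hmul : ∀ j, LpLim (3 / 2) atTop (fun n x => φ i n x * pd j (φ i n) x)
        (fun x => u x i * A i j x) := fun j => (hφ i).lim.mul h32 ((hφ i).lim_pd j)
    have hl := LpLim.sum Finset.univ le_rfl fun j _ => (LpLim.const (l := atTop) (hρu j)).mul
      (r := 1) le_rfl (hmul j)
    have ht := hl.tendsto_integral
    have hz : ∀ n, ∫ x, ∑ j, ρ x * u x j * (φ i n x * pd j (φ i n) x) = 0 := by
      intro n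
      have h1 := hsol.mass_balance_pd (((hφ i).test n).mul ((hφ i).test n))
      have hd := ((hφ i).test n).differentiable
      have e : ∀ x, ∑ j, ρ x * u x j * pd j (fun y => φ i n y * φ i n y) x =
          2 * ∑ j, ρ x * u x j * (φ i n x * pd j (φ i n) x) := fun x => by
        rw [Finset.mul_sum]
        refine Finset.sum_congr rfl fun j _ => ?_
        rw [pd_mul hd hd]
        ring
      simp only [e, integral_const_mul] at h1
      linarith
    simp only [hz] at ht
    have h0 := tendsto_nhds_unique ht tendsto_const_nhds
    rw [integral_finsetSum _ fun j _ => memLp_one_iff_integrable.1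
      ((hmul j).memLp_lim.mul' (p := 3) (r := 1) (hρu j))] at h0
    rw [← h0]
    refine Finset.sum_congr rfl fun j _ => ?_
    congr 1
    ext x
    ring
  -- Energy identity: the velocity is an admissible test field in the momentum balance.
  have henergy : ∑ i, ∫ x, ρ x ^ γ * A i i x =
      (∑ i, ∑ j, ∫ x, (viscousStress μ η (weakJacobian u x) i j - ρ x * u x i * u x j) * A i j x)
        - ∑ i, ∫ x, ρ x * weakGradient G x i * u x i := by
    have t1 := (LpLim.sum Finset.univ le_rfl fun i _ => (LpLim.const (l := atTop) hP2).mul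
      (r := 1) le_rfl ((hφ i).lim_pd i)).tendsto_integral
    rw [integral_finsetSum _ fun i _ => memLp_one_iff_integrable.1
      ((hA2 i i).mul' (p := 2) (r := 1) hP2)] at t1
    have t2 := tendsto_finsetSum Finset.univ fun i _ => tendsto_finsetSum Finset.univ fun j _ =>
      ((LpLim.const (l := atTop) (hH i j)).mul (r := 1) le_rfl ((hφ i).lim_pd j)).tendsto_integral
    have t3 := tendsto_finsetSum Finset.univ fun i _ =>
      ((LpLim.const (l := atTop) (hF i)).mul (r := 1) le_rfl (hφ i).lim).tendsto_integral
    refine tendsto_nhds_unique t1 ((t2.sub t3).congr fun n => ?_)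
    rw [← hmom (fun i => φ i n) fun i => (hφ i).test n]
    simp only [Finset.mul_sum]
  have hdiss : ∑ i, ∑ j,
      ∫ x, viscousStress μ η (Matrix.of fun i j => A i j x) i j * A i j x = 0 := by
    have e : ∀ i j,
        ∫ x, (viscousStress μ η (weakJacobian u x) i j - ρ x * u x i * u x j) * A i j x =
        (∫ x, viscousStress μ η (Matrix.of fun i j => A i j x) i j * A i j x) -
          ∫ x, ρ x * u x i * u x j * A i j x := fun i j => by
      simp only [sub_mul]
      exact integral_sub ((hS i j).integrable_mul (hA2 i j)) ((hT i j).integrable_mul (hA2 i j))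
    simp only [e, Finset.sum_sub_distrib, hconv] at henergy
    rw [hpress, hforce] at henergy
    simp only [Finset.sum_const_zero] at henergy
    linarith
  have hA0 := ae_eq_zero_of_dissipation_eq_zero hμ hη hφ hdiss
  have hu0 := ae_all_iff.2 fun i => (hφ i).ae_eq_zero (hA0 i)
  filter_upwards [hu0] with x hx
  ext i
  exact hx i
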